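/- A \emph{superalgebra} is a unital associative $\mathbb{Z}/2$-graded real algebra $A=A_0\oplus A_1$; it is (super)commutative if $ab=(-1)^{ij}ba$ for $a\in A_i$, $b\in A_j$, and superalgebra morphisms are parity-preserving unital algebra homomorphisms. A \emph{superdomain} $U$ of dimension $p|q$ is an open set $|U|\subseteq\mathbb{R}^p$ with the sheaf of superalgebras $\mathcal{O}_U(W)=C^\infty(W)\otimes\Lambda(\theta_1,\dots,\theta_q)$, $W\subseteq|U|$ open. A morphism of supermanifolds $\varphi\colon U\to V$ between superdomains is a continuous map $|\varphi|\colon|U|\to|V|$ together with a morphism of sheaves of superalgebras $\varphi^*\colon\mathcal{O}_V\to|\varphi|_*\mathcal{O}_U$ which sends the maximal ideal of the stalk at $|\varphi|(x)$ (the germs whose value at $|\varphi|(x)$ is zero) into the maximal ideal of the stalk at $x$, for every $x\in|U|$. A \emph{super Weil algebra} is a finite-dimensional commutative superalgebra $A=\mathbb{R}\oplus\mathring{A}$ with $\mathring{A}$ a graded nilpotent ideal; with superalgebra morphisms these form a category $\mathbf{SWA}$. For a superdomain $U$ let $U_{(-)}\colon\mathbf{SWA}\to\mathbf{Set}$ be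 the functor $A\mapsto U_A=\mathrm{Hom}(\mathcal{O}_U(|U|),A)$ (superalgebra morphisms), with $\rho\colon A\to B$ acting by $x_A\mapsto\rho\circ x_A$. A morphism $\varphi\colon U\to V$ induces the natural transformation $\varphi_A(x_A)=x_A\circ\varphi^*$. Through the images of the coordinates $x_1,\dots,x_p,\theta_1,\dots,\theta_q$, the set $U_A$ is identified with the open subset of the $A_0$-module $A_0^p\times A_1^q$ consisting of the points whose real part (the class modulo $\mathring{A}$ of the even coordinates) lies in $|U|$. A map $U_A\to V_A$ is called \emph{$A_0$-smooth} if, under these identifications, it is smooth and its differential at every point is $A_0$-linear. \textbf{Lemma.} Let $U$ and $V$ be superdomains, of dimensions $p|q$ and $m|n$, and let $\alpha_{(-)}\colon U_{(-)}\to V_{(-)}$ be a natural transformation of functors $\mathbf{SWA}\to\mathbf{Set}$. Then there is a morphism of supermanifolds $\varphi\colon U\to V$ with $\alpha_A=\varphi_A$ for every super Weil algebra $A$ if and only if $\alpha_A\colon U_A\to V_A$ is $A_0$-smooth for every super Weil algebra $A$. -/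

import Mathlib

open CategoryTheory TopologicalSpace
open scoped Manifold ContDiff TensorProduct

noncomputable section

namespace SuperGeometry

/-! ### Superdomains and their structure sheaf -/

/-- Smooth real functions on an open subset of `ℝ^p`. -/
abbrev SmoothFun (p : ℕ) (W : Opens (EuclideanSpace ℝ (Fin p))) : Type :=
  C^∞⟮𝓘(ℝ, EuclideanSpace ℝ (Fin p)), W; 𝓘(ℝ, ℝ), ℝ⟯

/-- The real Grassmann algebra in `q` odd generators. -/
abbrev Grassmann (q : ℕ) : Type := ExteriorAlgebra ℝ (Fin q → ℝ)

/-- The even (`i = 0`) and odd (`i = 1`) parts of the Grassmann algebra. -/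
abbrev grassmannGrading (q : ℕ) : ZMod 2 → Submodule ℝ (Grassmann q) :=
  CliffordAlgebra.evenOdd (0 : QuadraticForm ℝ (Fin q → ℝ))

/-- The sections over `W` of the structure sheaf of `ℝ^{p|q}`: `C^∞(W) ⊗ Λ(θ₁, …, θ_q)`. -/
abbrev Sections (p q : ℕ) (W : Opens (EuclideanSpace ℝ (Fin p))) : Type :=
  SmoothFun p W ⊗[ℝ] Grassmann q

/-- The parity grading of `C^∞(W) ⊗ Λ(θ₁, …, θ_q)`: the part of parity `i` is the image of
`C^∞(W) ⊗ Λ_i`. -/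
def sectionsGrading (p q : ℕ) (W : Opens (EuclideanSpace ℝ (Fin p))) :
    ZMod 2 → Submodule ℝ (Sections p q W) :=
  fun i => ((grassmannGrading q i).baseChange (SmoothFun p W)).restrictScalars ℝ

instance sectionsGradedAlgebra (p q : ℕ) (W : Opens (EuclideanSpace ℝ (Fin p))) :
    GradedAlgebra (sectionsGrading p q W) :=
  let h : GradedAlgebra fun i => (grassmannGrading q i).baseChange (SmoothFun p W) :=
    GradedAlgebra.baseChange (grassmannGrading q)
  { one_mem := h.one_mem
    mul_mem := h.mul_mem
    decompose' := h.decompose'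
    left_inv := h.left_inv
    right_inv := h.right_inv }

/-- Restriction of smooth functions to a smaller open set. -/
def restrictFun (p : ℕ) {W' W : Opens (EuclideanSpace ℝ (Fin p))} (h : W' ≤ W) :
    SmoothFun p W →ₐ[ℝ] SmoothFun p W' :=
  { ContMDiffMap.restrictRingHom 𝓘(ℝ, EuclideanSpace ℝ (Fin p)) 𝓘(ℝ, ℝ) ℝ h with
    commutes' := fun _ => rfl }

/-- The restriction maps of the structure sheaf of `ℝ^{p|q}`. -/
def restrict (p q : ℕ) {W' W : Opens (EuclideanSpace ℝ (Fin p))} (h : W' ≤ W) :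
    sectionsGrading p q W →ₐᵍ[ℝ] sectionsGrading p q W' :=
  { Algebra.TensorProduct.map (restrictFun p h) (AlgHom.id ℝ (Grassmann q)) with
    map_mem := by
      intro i s hs
      change s ∈ (grassmannGrading q i).baseChange (SmoothFun p W) at hs
      rw [Submodule.baseChange_eq_span] at hs
      change _ ∈ (grassmannGrading q i).baseChange (SmoothFun p W')
      induction hs using Submodule.span_induction with
      | mem y hy =>
        obtain ⟨t, ht, rfl⟩ := hy
        exact Submodule.tmul_mem_baseChange_of_mem _ ht
      | zero => simp
      | add y z _ _ hy hz => simpa using add_mem hy hz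
      | smul c y _ hy =>
        have key : (Algebra.TensorProduct.map (restrictFun p h) (AlgHom.id ℝ (Grassmann q)))
            (c • y) = restrictFun p h c •
              (Algebra.TensorProduct.map (restrictFun p h) (AlgHom.id ℝ (Grassmann q))) y := by
          have e : c • y = (c ⊗ₜ[ℝ] (1 : Grassmann q)) * y := Algebra.smul_def c y
          have e' (z : Sections p q W') : restrictFun p h c • z =
              (restrictFun p h c ⊗ₜ[ℝ] (1 : Grassmann q)) * z := Algebra.smul_def _ z
          rw [e, e', map_mul, Algebra.TensorProduct.map_tmul, map_one]
        exact key ▸ Submodule.smul_mem _ _ hy }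

/-- Evaluation of smooth functions at a point. -/
def evalFun (p : ℕ) {W : Opens (EuclideanSpace ℝ (Fin p))} (x : W) : SmoothFun p W →ₐ[ℝ] ℝ :=
  { toFun := fun f => f x
    map_one' := rfl
    map_mul' := fun _ _ => rfl
    map_zero' := rfl
    map_add' := fun _ _ => rfl
    commutes' := fun _ => rfl }

/-- The value `s̃(x)` of a section at a point `x`: evaluate the component of `s` of degree zero
in the odd generators. -/
def value (p q : ℕ) {W : Opens (EuclideanSpace ℝ (Fin p))} (x : W) : Sections p q W →ₐ[ℝ] ℝ :=
  Algebra.TensorProduct.lift (evalFun p x) (ExteriorAlgebra.algebraMapInv (R := ℝ))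
    (fun _ _ => Commute.all _ _)

/-- A superdomain: an open subset of `ℝ^p`, with the structure sheaf of `ℝ^{p|q}` restricted
to it. -/
structure Superdomain where
  evenDim : ℕ
  oddDim : ℕ
  carrier : Opens (EuclideanSpace ℝ (Fin evenDim))

namespace Superdomain

/-- The superalgebra of sections of the structure sheaf of `U` over an open `W ⊆ U`
(its graded pieces). -/
abbrev sheaf (U : Superdomain) (W : Opens (EuclideanSpace ℝ (Fin U.evenDim))) :
    ZMod 2 → Submodule ℝ (Sections U.evenDim U.oddDim W) :=
  sectionsGrading U.evenDim U.oddDim W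

/-- The superalgebra `𝒪(U)` of global sections. -/
abbrev globalSections (U : Superdomain) :
    ZMod 2 → Submodule ℝ (Sections U.evenDim U.oddDim U.carrier) :=
  U.sheaf U.carrier

/-- The preimage in `U` of an open set under a continuous map `U → V`, as an open subset of
the ambient Euclidean space. -/
def preimage {U V : Superdomain} (f : C(U.carrier, V.carrier))
    (W : Opens (EuclideanSpace ℝ (Fin V.evenDim))) :
    Opens (EuclideanSpace ℝ (Fin U.evenDim)) :=
  ⟨Subtype.val '' {x : U.carrier | (f x : EuclideanSpace ℝ (Fin V.evenDim)) ∈ W},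
    U.carrier.isOpen.isOpenMap_subtype_val _
      (W.isOpen.preimage (continuous_subtype_val.comp f.continuous))⟩

theorem preimage_mono {U V : Superdomain} (f : C(U.carrier, V.carrier))
    {W' W : Opens (EuclideanSpace ℝ (Fin V.evenDim))} (h : W' ≤ W) :
    preimage f W' ≤ preimage f W :=
  Set.image_mono fun _ hx => h hx

theorem le_preimage_carrier {U V : Superdomain} (f : C(U.carrier, V.carrier)) :
    U.carrier ≤ preimage f V.carrier :=
  fun x hx => ⟨⟨x, hx⟩, (f ⟨x, hx⟩).2, rfl⟩

/-- A morphism of supermanifolds `U → V` between superdomains, i.e. a morphism of superspaces: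
a continuous map together with a morphism of sheaves of superalgebras
`φ^* : 𝒪_V → φ_* 𝒪_U` that is local on stalks. The maximal ideal of the stalk at a point
consists of the germs whose value at that point is zero. -/
structure Hom (U V : Superdomain) where
  base : C(U.carrier, V.carrier)
  pullback : ∀ W : Opens (EuclideanSpace ℝ (Fin V.evenDim)), W ≤ V.carrier →
    (V.sheaf W →ₐᵍ[ℝ] U.sheaf (preimage base W))
  pullback_restrict : ∀ (W' W : Opens (EuclideanSpace ℝ (Fin V.evenDim))) (h : W' ≤ W)
    (hW : W ≤ V.carrier) (s : Sections V.evenDim V.oddDim W),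
    restrict U.evenDim U.oddDim (preimage_mono base h) (pullback W hW s) =
      pullback W' (h.trans hW) (restrict V.evenDim V.oddDim h s)
  pullback_local : ∀ (W : Opens (EuclideanSpace ℝ (Fin V.evenDim))) (hW : W ≤ V.carrier)
    (x : U.carrier) (hx : (base x : EuclideanSpace ℝ (Fin V.evenDim)) ∈ W)
    (s : Sections V.evenDim V.oddDim W),
    value V.evenDim V.oddDim (⟨base x, hx⟩ : W) s = 0 →
      value U.evenDim U.oddDim (⟨x, x, hx, rfl⟩ : preimage base W) (pullback W hW s) = 0

/-- The pullback of global sections `𝒪(V) → 𝒪(U)`. -/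
def Hom.globalPullback {U V : Superdomain} (φ : U.Hom V) :
    V.globalSections →ₐᵍ[ℝ] U.globalSections :=
  (restrict U.evenDim U.oddDim (le_preimage_carrier φ.base)).comp (φ.pullback V.carrier le_rfl)

/-- The `i`-th even coordinate function of `U`, as an even global section. -/
def evenCoord (U : Superdomain) (i : Fin U.evenDim) : U.globalSections 0 :=
  ⟨(⟨fun x : U.carrier => (x : EuclideanSpace ℝ (Fin U.evenDim)) i, by
      have h : ContMDiff 𝓘(ℝ, EuclideanSpace ℝ (Fin U.evenDim)) 𝓘(ℝ, ℝ) ∞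
          fun x : EuclideanSpace ℝ (Fin U.evenDim) => x i :=
        (contDiff_piLp_apply (i := i) 2).contMDiff
      exact h.comp contMDiff_subtype_val⟩ : SmoothFun U.evenDim U.carrier) ⊗ₜ[ℝ] (1 : Grassmann U.oddDim),
    Submodule.tmul_mem_baseChange_of_mem _ (SetLike.GradedOne.one_mem)⟩

/-- The `j`-th odd coordinate of `U`, as an odd global section. -/
def oddCoord (U : Superdomain) (j : Fin U.oddDim) : U.globalSections 1 :=
  ⟨(1 : SmoothFun U.evenDim U.carrier) ⊗ₜ[ℝ] ExteriorAlgebra.ι ℝ (Pi.single j (1 : ℝ)),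
    Submodule.tmul_mem_baseChange_of_mem _ (CliffordAlgebra.ι_mem_evenOdd_one _ _)⟩

end Superdomain

/-! ### Super Weil algebras -/

/-- A real super Weil algebra: a finite-dimensional supercommutative unital superalgebra
`A = ℝ ⊕ nil` with `nil` a graded nilpotent ideal. -/
structure SuperWeilAlgebra where
  carrier : Type
  [ring : Ring carrier]
  [algebra : Algebra ℝ carrier]
  [nontrivial : Nontrivial carrier]
  [finite : Module.Finite ℝ carrier]
  /-- the even part `grading 0` and the odd part `grading 1` -/
  grading : ZMod 2 → Submodule ℝ carrier
  [graded : GradedAlgebra grading]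
  supercomm : ∀ (i j : ZMod 2), ∀ a ∈ grading i, ∀ b ∈ grading j,
    a * b = (-1) ^ (i.val * j.val) * (b * a)
  nil : Ideal carrier
  nil_isTwoSided : nil.IsTwoSided
  nil_isHomogeneous : nil.IsHomogeneous grading
  nil_isNilpotent : IsNilpotent nil
  isCompl_nil : IsCompl (1 : Submodule ℝ carrier) (nil.restrictScalars ℝ)

namespace SuperWeilAlgebra

attribute [instance] SuperWeilAlgebra.ring SuperWeilAlgebra.algebra SuperWeilAlgebra.nontrivial
  SuperWeilAlgebra.finite SuperWeilAlgebra.graded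

/-- The category of super Weil algebras: morphisms are parity-preserving unital algebra
homomorphisms. -/
instance : Category SuperWeilAlgebra where
  Hom A B := A.grading →ₐᵍ[ℝ] B.grading
  id A := GradedAlgHom.id ℝ A.grading
  comp f g := GradedAlgHom.comp g f

/-- Multiplication by an even element, on the part of parity `i`. -/
def evenMul (A : SuperWeilAlgebra) {i : ZMod 2} (a : A.grading 0) (v : A.grading i) :
    A.grading i :=
  ⟨(a : A.carrier) * (v : A.carrier), by
    simpa using SetLike.mul_mem_graded a.2 v.2⟩

end SuperWeilAlgebra

/-! ### The functor of `A`-points -/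

namespace Superdomain

/-- The functor `U_(-)` of `A`-points: `U_A = Hom(𝒪(U), A)`. -/
def points (U : Superdomain) : SuperWeilAlgebra ⥤ Type where
  obj A := U.globalSections →ₐᵍ[ℝ] A.grading
  map {A B} (ρ : A.grading →ₐᵍ[ℝ] B.grading) := ↾fun x : U.globalSections →ₐᵍ[ℝ] A.grading => ρ.comp x

/-- The natural transformation induced by a morphism of superdomains,
`φ_A(x_A) = x_A ∘ φ^*`. -/
def Hom.onPoints {U V : Superdomain} (φ : U.Hom V) : U.points ⟶ V.points where
  app A := ↾fun (x : U.globalSections →ₐᵍ[ℝ] A.grading) => x.comp φ.globalPullback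
  naturality _ _ _ := rfl

/-- The `A₀`-module `A₀^p × A₁^q`. -/
abbrev CoordSpace (U : Superdomain) (A : SuperWeilAlgebra) : Type :=
  (Fin U.evenDim → A.grading 0) × (Fin U.oddDim → A.grading 1)

/-- The action of `A₀` on `A₀^p × A₁^q`. -/
def evenSMul (U : Superdomain) {A : SuperWeilAlgebra} (a : A.grading 0) (z : U.CoordSpace A) :
    U.CoordSpace A :=
  (fun i => A.evenMul a (z.1 i), fun j => A.evenMul a (z.2 j))

/-- The `A`-valued coordinates of an `A`-point. -/
def coords (U : Superdomain) {A : SuperWeilAlgebra} (x : U.points.obj A) : U.CoordSpace A :=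
  let x' : U.globalSections →ₐᵍ[ℝ] A.grading := x
  (fun i => ⟨x' (U.evenCoord i), x'.map_mem (U.evenCoord i).2⟩,
   fun j => ⟨x' (U.oddCoord j), x'.map_mem (U.oddCoord j).2⟩)

/-- The open subset of `A₀^p × A₁^q` with which `U_A` is identified: the points whose real part
lies in `U`. -/
def coordDomain (U : Superdomain) (A : SuperWeilAlgebra) : Set (U.CoordSpace A) :=
  {z | ∃ u ∈ U.carrier, ∀ i, (z.1 i : A.carrier) - algebraMap ℝ A.carrier (u i) ∈ A.nil}

end Superdomain

/-! ### Smoothness over the even part -/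

section FiniteDimensional

variable {E F : Type} [AddCommGroup E] [Module ℝ E] [Module.Finite ℝ E]
  [AddCommGroup F] [Module ℝ F] [Module.Finite ℝ F]

/-- Linear coordinates on a finite-dimensional real vector space. Smoothness and differentials
do not depend on the choice of basis. -/
def linearCoords (E : Type) [AddCommGroup E] [Module ℝ E] [Module.Finite ℝ E] :
    E ≃ₗ[ℝ] (Fin (Module.finrank ℝ E) → ℝ) :=
  (Module.finBasis ℝ E).equivFun

/-- A map between finite-dimensional real vector spaces, read in linear coordinates. -/
def coordExpr (f : E → F) : (Fin (Module.finrank ℝ E) → ℝ) → (Fin (Module.finrank ℝ F) → ℝ) :=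
  fun y => linearCoords F (f ((linearCoords E).symm y))

/-- `f` is smooth on `S`. -/
def SmoothOn (f : E → F) (S : Set E) : Prop :=
  ContDiffOn ℝ ∞ (coordExpr f) ((linearCoords E).symm ⁻¹' S)

/-- The differential of `f` at `z`. -/
def differential (f : E → F) (z : E) : E →ₗ[ℝ] F :=
  (linearCoords F).symm.toLinearMap ∘ₗ
    (fderiv ℝ (coordExpr f) (linearCoords E z)).toLinearMap ∘ₗ (linearCoords E).toLinearMap

end FiniteDimensional

/-- A map `g : U_A → V_A` is `A₀`-smooth if, in the `A`-valued coordinates which identify `U_A`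
and `V_A` with open subsets of the `A₀`-modules `A₀^p × A₁^q` and `A₀^m × A₁^n`, it is smooth and
its differential at each point is `A₀`-linear. -/
def IsA0Smooth {U V : Superdomain} {A : SuperWeilAlgebra}
    (g : U.points.obj A → V.points.obj A) : Prop :=
  ∃ f : U.CoordSpace A → V.CoordSpace A,
    (∀ x : U.points.obj A, V.coords (g x) = f (U.coords x)) ∧
    SmoothOn f (U.coordDomain A) ∧
    ∀ z ∈ U.coordDomain A, ∀ (a : A.grading 0) (v : U.CoordSpace A),
      differential f z (U.evenSMul a v) = V.evenSMul a (differential f z v)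

end SuperGeometry

end

open CategoryTheory TopologicalSpace
open scoped Manifold ContDiff TensorProduct

noncomputable section

/-! Call an `A`-valued function on `U_A` super smooth if it is smooth with `A₀`-linear differential.
Everything rests on a rigidity principle (`IsSuperSmooth.eq_zero`): such a function vanishes as soon
as it vanishes at the points whose even coordinates are real, the odd coordinates being arbitrary.
Indeed its derivatives in the even basis directions are again super smooth and vanish at those
points. Moving from such a point by the nilpotent part of the even coordinates multiplies these
derivatives by nilpotents, so by induction the values lie in every power of the nilpotent ideal.

For a morphism `φ`, the coordinates of `x ∘ φ^*` are the values at `x` of the pulled back coordinate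
sections, so it suffices that every global section is super smooth as a function on `U_A`. A smooth
function acts through its finite Taylor series in the nilpotent directions (`weilExtension`), whose
differential is `v ↦ ∑ vᵢ · (∂ᵢf)` and hence `A₀`-linear (`fderiv_weilExtension`). That this
evaluation describes all of `U_A` follows from two facts: real characters of smooth functions are
point evaluations (`exists_eq_eval`), and morphisms to a super Weil algebra are determined by the
coordinates, by Hadamard's lemma (`smoothFun_algHom_ext`).

Conversely, take for `A` the Grassmann algebra on the odd coordinates of `U`, and for each `u` in
`U` the generic point with even coordinates `u` and odd coordinates the generators. The images of
these points under `α` have coordinates depending smoothly on `u`. Evaluating sections of `V` on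
this family yields smooth Grassmann-valued functions, that is, sections of `U`, and so a morphism
`φ` (`homOfCoords`). By construction `φ` and `α` agree on generic points. Every point with real even
coordinates is the image of a generic point under a morphism of super Weil algebras, so naturality
spreads the agreement to these, and rigidity to all of `U_A` (`eq_of_isA0Smooth`). -/

namespace SuperGeometry

/-! ### Auxiliary norms and basis-free smoothness. -/

section Normed

attribute [local instance] Matrix.linftyOpNormedRing Matrix.linftyOpNormedAlgebra

/-- The left regular representation embeds `A` in a matrix algebra with a submultiplicative norm.
This makes Fréchet calculus, including the product rule, available on `A`; smoothness and
differentials do not depend on the norm. -/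
instance (A : SuperWeilAlgebra) : NormedRing A.carrier :=
  NormedRing.induced A.carrier
    (Matrix (Fin (Module.finrank ℝ A.carrier)) (Fin (Module.finrank ℝ A.carrier)) ℝ)
    (Algebra.leftMulMatrix (Module.finBasis ℝ A.carrier)) (Algebra.leftMulMatrix_injective _)

instance (A : SuperWeilAlgebra) : NormedAlgebra ℝ A.carrier :=
  NormedAlgebra.induced ℝ A.carrier
    (Matrix (Fin (Module.finrank ℝ A.carrier)) (Fin (Module.finrank ℝ A.carrier)) ℝ)
    (Algebra.leftMulMatrix (Module.finBasis ℝ A.carrier))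

end Normed

section FiniteDimensional

variable {E F : Type} [NormedAddCommGroup E] [NormedSpace ℝ E] [FiniteDimensional ℝ E]
  [NormedAddCommGroup F] [NormedSpace ℝ F] [FiniteDimensional ℝ F]

theorem coordExpr_eq (f : E → F) :
    coordExpr f = (linearCoords F).toContinuousLinearEquiv ∘ f ∘
      (linearCoords E).toContinuousLinearEquiv.symm :=
  rfl

/-- Linear coordinates on a finite-dimensional normed space are a continuous linear equivalence, so
they can be removed on both sides. -/
theorem smoothOn_iff_contDiffOn (f : E → F) (S : Set E) : SmoothOn f S ↔ ContDiffOn ℝ ∞ f S := by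
  rw [SmoothOn, coordExpr_eq, ContinuousLinearEquiv.comp_contDiffOn_iff]
  exact (linearCoords E).toContinuousLinearEquiv.symm.contDiffOn_comp_iff

theorem differential_eq_fderiv (f : E → F) (z : E) (v : E) :
    differential f z v = fderiv ℝ f z v := by
  have h := (linearCoords E).toContinuousLinearEquiv.symm.comp_right_fderiv (f := f)
    (x := linearCoords E z)
  have h' := (linearCoords F).toContinuousLinearEquiv.comp_fderiv
    (f := f ∘ (linearCoords E).toContinuousLinearEquiv.symm) (x := linearCoords E z)
  rw [differential, coordExpr_eq, h', h]
  have e : (linearCoords E).toContinuousLinearEquiv.symm (linearCoords E z) = z :=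
    (linearCoords E).symm_apply_apply z
  have e' : (linearCoords E).toContinuousLinearEquiv.symm (linearCoords E v) = v :=
    (linearCoords E).symm_apply_apply v
  simp only [LinearMap.comp_apply, ContinuousLinearMap.coe_coe, LinearEquiv.coe_coe,
    ContinuousLinearMap.comp_apply, ContinuousLinearEquiv.coe_coe, e, e']
  exact (linearCoords F).symm_apply_apply _

end FiniteDimensional

/-! ### Real parts, nilpotents and signs in a super Weil algebra. -/

namespace SuperWeilAlgebra

variable (A : SuperWeilAlgebra)

theorem algebraMap_mem_nil_iff {r : ℝ} : algebraMap ℝ A.carrier r ∈ A.nil ↔ r = 0 := by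
  refine ⟨fun h => ?_, fun h => by simp [h]⟩
  have := (Submodule.disjoint_def.1 A.isCompl_nil.disjoint) _
    (Submodule.algebraMap_mem r) h
  exact (algebraMap ℝ A.carrier).injective (by simpa using this)

theorem exists_sub_algebraMap_mem_nil (a : A.carrier) :
    ∃ r : ℝ, a - algebraMap ℝ A.carrier r ∈ A.nil := by
  have h : a ∈ (1 : Submodule ℝ A.carrier) ⊔ A.nil.restrictScalars ℝ := by
    rw [A.isCompl_nil.sup_eq_top]; trivial
  obtain ⟨y, hy, n, hn, rfl⟩ := Submodule.mem_sup.1 h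
  obtain ⟨r, rfl⟩ := Submodule.mem_one.1 hy
  exact ⟨r, by simpa using hn⟩

theorem nil_eq_of_sub_mem {a : A.carrier} {r s : ℝ} (hr : a - algebraMap ℝ A.carrier r ∈ A.nil)
    (hs : a - algebraMap ℝ A.carrier s ∈ A.nil) : r = s := by
  rw [← sub_eq_zero, ← A.algebraMap_mem_nil_iff, map_sub]
  simpa using sub_mem hs hr

/-- The real part of an element of a super Weil algebra. -/
def body : A.carrier →ₐ[ℝ] ℝ :=
  have key (a : A.carrier) := (A.exists_sub_algebraMap_mem_nil a).choose_spec
  AlgHom.ofLinearMap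
    { toFun := fun a => (A.exists_sub_algebraMap_mem_nil a).choose
      map_add' := fun a b => A.nil_eq_of_sub_mem (key (a + b)) (by
        have := add_mem (key a) (key b)
        rw [map_add]
        convert this using 1
        abel)
      map_smul' := fun c a => A.nil_eq_of_sub_mem (key (c • a)) (by
        have := A.nil.mul_mem_left (algebraMap ℝ A.carrier c) (key a)
        rwa [mul_sub, ← map_mul, ← Algebra.smul_def] at this) }
    (A.nil_eq_of_sub_mem (key 1) (by simp))
    (fun a b => A.nil_eq_of_sub_mem (key (a * b)) (by
      have := A.nil_isTwoSided
      have h := add_mem (A.nil.mul_mem_right b (key a))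
        (A.nil.mul_mem_left (algebraMap ℝ A.carrier (A.exists_sub_algebraMap_mem_nil a).choose)
          (key b))
      rw [sub_mul, mul_sub, ← map_mul, sub_add_sub_cancel] at h
      exact h))

theorem sub_body_mem_nil (a : A.carrier) : a - algebraMap ℝ A.carrier (A.body a) ∈ A.nil :=
  (A.exists_sub_algebraMap_mem_nil a).choose_spec

theorem body_eq_iff {a : A.carrier} {r : ℝ} :
    A.body a = r ↔ a - algebraMap ℝ A.carrier r ∈ A.nil :=
  ⟨fun h => h ▸ A.sub_body_mem_nil a, A.nil_eq_of_sub_mem (A.sub_body_mem_nil a)⟩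

theorem mem_nil_iff {a : A.carrier} : a ∈ A.nil ↔ A.body a = 0 := by
  rw [body_eq_iff]; simp

theorem nil_pow_eq_zero : ∃ K, ∀ a ∈ A.nil ^ K, a = 0 := by
  obtain ⟨K, hK⟩ := A.nil_isNilpotent
  exact ⟨K, fun a ha => by rw [hK] at ha; simpa using ha⟩

theorem even_mul_comm {a : A.carrier} (ha : a ∈ A.grading 0) (b : A.carrier) : a * b = b * a := by
  induction b using DirectSum.Decomposition.inductionOn A.grading with
  | zero => simp
  | homogeneous b =>
    rename_i i
    simpa using A.supercomm 0 i a ha b b.2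
  | add b c hb hc => rw [mul_add, add_mul, hb, hc]

theorem odd_mul_self {a : A.carrier} (ha : a ∈ A.grading 1) : a * a = 0 := by
  have h := A.supercomm 1 1 a ha a ha
  have h1 : (-1 : A.carrier) ^ ((1 : ZMod 2).val * (1 : ZMod 2).val) = -1 := by
    simp [ZMod.val_one]
  rw [h1, neg_one_mul] at h
  have h2 : (2 : ℝ) • (a * a) = 0 := by
    rw [two_smul]
    nth_rewrite 1 [h]
    exact neg_add_cancel _
  exact (smul_eq_zero.1 h2).resolve_left two_ne_zero

theorem odd_body_eq_zero {a : A.carrier} (ha : a ∈ A.grading 1) : A.body a = 0 := by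
  have := congrArg A.body (A.odd_mul_self ha)
  simpa using this

theorem algebraMap_mem_even (r : ℝ) : algebraMap ℝ A.carrier r ∈ A.grading 0 :=
  SetLike.algebraMap_mem_graded _ _

end SuperWeilAlgebra

/-! ### The `A₀`-module of coordinates and its real points. -/

namespace Superdomain

variable (U : Superdomain) (A : SuperWeilAlgebra)

/-- The real part of a point of `A₀^p × A₁^q`. -/
def realPart : U.CoordSpace A →L[ℝ] EuclideanSpace ℝ (Fin U.evenDim) :=
  LinearMap.toContinuousLinearMap
    { toFun := fun z => WithLp.toLp 2 fun i => A.body (z.1 i)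
      map_add' := fun z w => by ext i; simp
      map_smul' := fun c z => by ext i; simp }

@[simp]
theorem realPart_apply (z : U.CoordSpace A) (i : Fin U.evenDim) :
    U.realPart A z i = A.body (z.1 i) :=
  rfl

/-- The `i`-th even coordinate function on `A₀^p × A₁^q`. -/
def evenProj (i : Fin U.evenDim) : U.CoordSpace A →L[ℝ] A.carrier :=
  LinearMap.toContinuousLinearMap
    ((A.grading 0).subtype ∘ₗ LinearMap.proj i ∘ₗ LinearMap.fst ℝ _ _)

@[simp]
theorem evenProj_apply (i : Fin U.evenDim) (z : U.CoordSpace A) :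
    U.evenProj A i z = (z.1 i : A.carrier) :=
  rfl

/-- The `j`-th odd coordinate function on `A₀^p × A₁^q`. -/
def oddProj (j : Fin U.oddDim) : U.CoordSpace A →L[ℝ] A.carrier :=
  LinearMap.toContinuousLinearMap
    ((A.grading 1).subtype ∘ₗ LinearMap.proj j ∘ₗ LinearMap.snd ℝ _ _)

@[simp]
theorem oddProj_apply (j : Fin U.oddDim) (z : U.CoordSpace A) :
    U.oddProj A j z = (z.2 j : A.carrier) :=
  rfl

/-- The nilpotent part of the `i`-th even coordinate. -/
def nilProj (i : Fin U.evenDim) : U.CoordSpace A →L[ℝ] A.carrier :=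
  U.evenProj A i - (Algebra.linearMap ℝ A.carrier).toContinuousLinearMap ∘L
    EuclideanSpace.proj i ∘L U.realPart A

theorem nilProj_apply (i : Fin U.evenDim) (z : U.CoordSpace A) :
    U.nilProj A i z = (z.1 i : A.carrier) - algebraMap ℝ A.carrier (A.body (z.1 i)) :=
  rfl

theorem nilProj_mem_nil (i : Fin U.evenDim) (z : U.CoordSpace A) : U.nilProj A i z ∈ A.nil :=
  A.sub_body_mem_nil _

theorem nilProj_mem_even (i : Fin U.evenDim) (z : U.CoordSpace A) :
    U.nilProj A i z ∈ A.grading 0 :=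
  sub_mem (z.1 i).2 (A.algebraMap_mem_even _)

variable {A}

theorem mem_coordDomain_iff {z : U.CoordSpace A} :
    z ∈ U.coordDomain A ↔ U.realPart A z ∈ U.carrier := by
  constructor
  · rintro ⟨u, hu, h⟩
    have : U.realPart A z = u := by
      ext i
      exact A.body_eq_iff.2 (h i)
    rwa [this]
  · exact fun h => ⟨_, h, fun i => A.sub_body_mem_nil _⟩

variable (A)

theorem coordDomain_eq : U.coordDomain A = U.realPart A ⁻¹' U.carrier := by
  ext z; exact U.mem_coordDomain_iff

theorem isOpen_coordDomain : IsOpen (U.coordDomain A) := by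
  rw [coordDomain_eq]
  exact U.carrier.isOpen.preimage (U.realPart A).continuous

/-- The `i`-th standard even basis vector of the `A₀`-module `A₀^p × A₁^q`. -/
def evenBasis (i : Fin U.evenDim) : U.CoordSpace A :=
  (Pi.single i ⟨1, SetLike.GradedOne.one_mem⟩, 0)

/-- The point of `A₀^p × A₁^q` with real even coordinates `u` and odd coordinates `ζ`. -/
def realPoint {A : SuperWeilAlgebra} (u : EuclideanSpace ℝ (Fin U.evenDim))
    (ζ : Fin U.oddDim → A.grading 1) : U.CoordSpace A :=
  (fun i => ⟨algebraMap ℝ A.carrier (u i), A.algebraMap_mem_even _⟩, ζ)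

@[simp]
theorem realPart_realPoint {A : SuperWeilAlgebra} (u : EuclideanSpace ℝ (Fin U.evenDim))
    (ζ : Fin U.oddDim → A.grading 1) : U.realPart A (U.realPoint u ζ) = u := by
  ext i; simp [realPoint]

theorem nilProj_realPoint {A : SuperWeilAlgebra} (u : EuclideanSpace ℝ (Fin U.evenDim))
    (ζ : Fin U.oddDim → A.grading 1) (i : Fin U.evenDim) :
    U.nilProj A i (U.realPoint u ζ) = 0 := by
  simp [nilProj_apply, realPoint]

theorem realPoint_add_smul_evenBasis {A : SuperWeilAlgebra}
    (u : EuclideanSpace ℝ (Fin U.evenDim))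
    (ζ : Fin U.oddDim → A.grading 1) (i : Fin U.evenDim) (t : ℝ) :
    U.realPoint u ζ + t • U.evenBasis A i =
      U.realPoint (u + t • EuclideanSpace.single i (1 : ℝ)) ζ := by
  ext j
  · by_cases h : j = i
    · subst h; simp [realPoint, evenBasis, Algebra.algebraMap_eq_smul_one, add_smul]
    · simp [realPoint, evenBasis, h]
  · simp [realPoint, evenBasis]

/-- The decomposition of a point into its real point and its nilpotent part. -/
theorem eq_realPoint_add_sum {A : SuperWeilAlgebra} (z : U.CoordSpace A) :
    z = U.realPoint (U.realPart A z) z.2 +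
      ∑ i, U.evenSMul ⟨U.nilProj A i z, U.nilProj_mem_even A i z⟩ (U.evenBasis A i) := by
  ext j
  · have : ∀ i, (((U.evenSMul ⟨U.nilProj A i z, U.nilProj_mem_even A i z⟩
        (U.evenBasis A i)).1 j : A.grading 0) : A.carrier) =
        if i = j then U.nilProj A i z else 0 := by
      intro i
      by_cases h : j = i
      · subst h; simp [evenSMul, evenBasis, SuperWeilAlgebra.evenMul]
      · simp [evenSMul, evenBasis, SuperWeilAlgebra.evenMul, h, Ne.symm h]
    simp only [Prod.fst_add, Prod.fst_sum, Pi.add_apply, Finset.sum_apply, Submodule.coe_add,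
      AddSubmonoidClass.coe_finsetSum, this]
    simp [realPoint, nilProj_apply]
  · simp [Prod.snd_sum, Finset.sum_apply, evenSMul, evenBasis, SuperWeilAlgebra.evenMul, realPoint]

theorem realPart_evenSMul_of_mem_nil {A : SuperWeilAlgebra} {a : A.grading 0}
    (ha : (a : A.carrier) ∈ A.nil) (v : U.CoordSpace A) : U.realPart A (U.evenSMul a v) = 0 := by
  ext i
  simp [evenSMul, SuperWeilAlgebra.evenMul, A.mem_nil_iff.1 ha]

/-- An `A`-valued function on `A₀^p × A₁^q` which is smooth over `U_A`, with `A₀`-linear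
differential. -/
structure IsSuperSmooth (g : U.CoordSpace A → A.carrier) : Prop where
  contDiffOn : ContDiffOn ℝ ∞ g (U.coordDomain A)
  fderiv_evenSMul : ∀ z ∈ U.coordDomain A, ∀ (a : A.grading 0) (v : U.CoordSpace A),
    fderiv ℝ g z (U.evenSMul a v) = a * fderiv ℝ g z v

/-! ### Calculus and rigidity of super smooth functions. -/

namespace IsSuperSmooth

variable {U A} {g h : U.CoordSpace A → A.carrier}

theorem differentiableAt (hg : U.IsSuperSmooth A g) {z : U.CoordSpace A}
    (hz : z ∈ U.coordDomain A) : DifferentiableAt ℝ g z :=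
  (hg.contDiffOn.contDiffAt ((U.isOpen_coordDomain A).mem_nhds hz)).differentiableAt (by simp)

theorem const (c : A.carrier) : U.IsSuperSmooth A fun _ => c :=
  ⟨contDiffOn_const, fun z _ a v => by simp⟩

theorem add (hg : U.IsSuperSmooth A g) (hh : U.IsSuperSmooth A h) :
    U.IsSuperSmooth A fun z => g z + h z :=
  ⟨hg.contDiffOn.add hh.contDiffOn, fun z hz a v => by
    rw [fderiv_fun_add (hg.differentiableAt hz) (hh.differentiableAt hz)]
    simp [hg.fderiv_evenSMul z hz, hh.fderiv_evenSMul z hz, mul_add]⟩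

theorem sub (hg : U.IsSuperSmooth A g) (hh : U.IsSuperSmooth A h) :
    U.IsSuperSmooth A fun z => g z - h z :=
  ⟨hg.contDiffOn.sub hh.contDiffOn, fun z hz a v => by
    rw [fderiv_fun_sub (hg.differentiableAt hz) (hh.differentiableAt hz)]
    simp [hg.fderiv_evenSMul z hz, hh.fderiv_evenSMul z hz, mul_sub]⟩

theorem mul (hg : U.IsSuperSmooth A g) (hh : U.IsSuperSmooth A h) :
    U.IsSuperSmooth A fun z => g z * h z :=
  ⟨hg.contDiffOn.mul hh.contDiffOn, fun z hz a v => by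
    rw [fderiv_fun_mul' (hg.differentiableAt hz) (hh.differentiableAt hz)]
    -- In the term where `h` is differentiated, the even scalar must pass to the left of `g z`; even
    -- elements are central.
    simp only [add_apply, smul_apply, smul_eq_mul,
      MulOpposite.smul_eq_mul_unop, MulOpposite.unop_op,
      hg.fderiv_evenSMul z hz, hh.fderiv_evenSMul z hz, mul_add, ← mul_assoc,
      A.even_mul_comm a.2 (g z)]⟩

theorem evenProj (i : Fin U.evenDim) : U.IsSuperSmooth A fun z => U.evenProj A i z :=
  ⟨(U.evenProj A i).contDiff.contDiffOn, fun z _ a v => by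
    rw [(U.evenProj A i).fderiv]; rfl⟩

theorem oddProj (j : Fin U.oddDim) : U.IsSuperSmooth A fun z => U.oddProj A j z :=
  ⟨(U.oddProj A j).contDiff.contDiffOn, fun z _ a v => by
    rw [(U.oddProj A j).fderiv]; rfl⟩

theorem sum {ι : Type*} (s : Finset ι) {g : ι → U.CoordSpace A → A.carrier}
    (hg : ∀ i ∈ s, U.IsSuperSmooth A (g i)) : U.IsSuperSmooth A fun z => ∑ i ∈ s, g i z := by
  classical
  induction s using Finset.induction_on with
  | empty => simpa using const 0
  | insert i s hi ih =>
    simp only [Finset.sum_insert hi]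
    exact (hg i (by simp)).add (ih fun j hj => hg j (by simp [hj]))

theorem congr (hg : U.IsSuperSmooth A g) (hgh : ∀ z ∈ U.coordDomain A, h z = g z) :
    U.IsSuperSmooth A h :=
  ⟨hg.contDiffOn.congr hgh, fun z hz a v => by
    have e := (Filter.eventuallyEq_of_mem ((U.isOpen_coordDomain A).mem_nhds hz) hgh).fderiv_eq
      (𝕜 := ℝ)
    rw [e, hg.fderiv_evenSMul z hz]⟩

/-- The derivative of a super smooth function in a fixed direction is super smooth. -/
theorem fderiv_apply (hg : U.IsSuperSmooth A g) (e : U.CoordSpace A) :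
    U.IsSuperSmooth A fun z => fderiv ℝ g z e := by
  have hd : ContDiffOn ℝ ∞ (fderiv ℝ g) (U.coordDomain A) :=
    hg.contDiffOn.fderiv_of_isOpen (U.isOpen_coordDomain A) (by simp)
  have hdd : ∀ z ∈ U.coordDomain A, DifferentiableAt ℝ (fderiv ℝ g) z := fun z hz =>
    (hd.contDiffAt ((U.isOpen_coordDomain A).mem_nhds hz)).differentiableAt (by simp)
  refine ⟨hd.clm_apply contDiffOn_const, fun z hz a v => ?_⟩
  have key (w w' : U.CoordSpace A) :
      fderiv ℝ (fun z => fderiv ℝ g z w) z w' = fderiv ℝ (fderiv ℝ g) z w' w := by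
    rw [fderiv_clm_apply (hdd z hz) (differentiableAt_const w)]
    simp
  have symm (w w' : U.CoordSpace A) :
      fderiv ℝ (fderiv ℝ g) z w w' = fderiv ℝ (fderiv ℝ g) z w' w :=
    (hg.contDiffOn.contDiffAt ((U.isOpen_coordDomain A).mem_nhds hz)).isSymmSndFDerivAt
      (by simpa using ENat.LEInfty.out) w w'
  -- By symmetry of the second derivative, `e` becomes the direction of the outer derivative, and
  -- the `A₀`-linearity of the first differential is then itself differentiated along `e`.
  rw [key, key, symm, ← key, symm v e, ← key]
  have ev : (fun z => fderiv ℝ g z (U.evenSMul a v)) =ᶠ[nhds z]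
      fun z => (a : A.carrier) * fderiv ℝ g z v :=
    Filter.eventuallyEq_of_mem ((U.isOpen_coordDomain A).mem_nhds hz)
      fun y hy => hg.fderiv_evenSMul y hy a v
  rw [ev.fderiv_eq, fderiv_const_mul ((hdd z hz).clm_apply (differentiableAt_const v))]
  simp

/-- Each integration along the nilpotent part of the even coordinates gains one power of the
nilpotent ideal. Since `ζ` is arbitrary in the hypothesis, no displacement in an odd direction is
needed, which is why linearity over `A₀` alone suffices. -/
theorem mem_nil_pow (k : ℕ) (hg : U.IsSuperSmooth A g)
    (h0 : ∀ u ∈ U.carrier, ∀ ζ, g (U.realPoint u ζ) = 0) :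
    ∀ z ∈ U.coordDomain A, g z ∈ A.nil ^ k := by
  induction k generalizing g with
  | zero => intro z _; rw [Submodule.pow_zero, Ideal.one_eq_top]; trivial
  | succ k ih =>
    intro z hz
    have hd (i : Fin U.evenDim) (y : U.CoordSpace A) (hy : y ∈ U.coordDomain A) :
        fderiv ℝ g y (U.evenBasis A i) ∈ A.nil ^ k := by
      -- The even basis vectors are real directions: moving along one from a point with real even
      -- coordinates stays among such points, where `g` is zero.
      refine ih (hg.fderiv_apply (U.evenBasis A i)) (fun u hu ζ => ?_) y hy
      have hmem : U.realPoint u ζ ∈ U.coordDomain A := by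
        rw [mem_coordDomain_iff, realPart_realPoint]; exact hu
      have h1 : HasDerivAt (fun t : ℝ => g (U.realPoint u ζ + t • U.evenBasis A i))
          (fderiv ℝ g (U.realPoint u ζ) (U.evenBasis A i)) 0 := by
        have hl : HasDerivAt (fun t : ℝ => U.realPoint u ζ + t • U.evenBasis A i)
            (U.evenBasis A i) 0 := by
          simpa using ((hasDerivAt_id (0 : ℝ)).smul_const (U.evenBasis A i)).const_add
            (U.realPoint u ζ)
        have hf : HasFDerivAt g (fderiv ℝ g (U.realPoint u ζ))
            (U.realPoint u ζ + (0 : ℝ) • U.evenBasis A i) := by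
          simpa using (hg.differentiableAt hmem).hasFDerivAt
        exact hf.comp_hasDerivAt 0 hl
      have h2 : (fun t : ℝ => g (U.realPoint u ζ + t • U.evenBasis A i)) =ᶠ[nhds 0]
          fun _ => 0 := by
        have hc : ContinuousAt
            (fun t : ℝ => u + t • EuclideanSpace.single i (1 : ℝ)) 0 := by fun_prop
        have hn := hc.eventually (U.carrier.isOpen.mem_nhds (by simpa using hu))
        filter_upwards [hn] with t ht
        rw [realPoint_add_smul_evenBasis]
        exact h0 _ ht ζ
      rw [← h1.deriv, h2.deriv_eq]
      simp
    set z0 := U.realPoint (U.realPart A z) z.2 with hz0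
    set n := ∑ i, U.evenSMul ⟨U.nilProj A i z, U.nilProj_mem_even A i z⟩ (U.evenBasis A i) with hn
    have hzn : z = z0 + n := U.eq_realPoint_add_sum z
    have hmem (t : ℝ) : z0 + t • n ∈ U.coordDomain A := by
      rw [mem_coordDomain_iff] at hz ⊢
      have : U.realPart A n = 0 := by
        rw [hn, map_sum]
        exact Finset.sum_eq_zero fun i _ =>
          U.realPart_evenSMul_of_mem_nil (U.nilProj_mem_nil A i z) _
      rw [map_add, map_smul, this, hz0, realPart_realPoint]
      simpa using hz
    have hder (t : ℝ) : HasDerivAt (fun t : ℝ => g (z0 + t • n)) (fderiv ℝ g (z0 + t • n) n) t := by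
      have hl : HasDerivAt (fun t : ℝ => z0 + t • n) n t := by
        simpa using ((hasDerivAt_id t).smul_const n).const_add z0
      exact (hg.differentiableAt (hmem t)).hasFDerivAt.comp_hasDerivAt t hl
    have hin (t : ℝ) : fderiv ℝ g (z0 + t • n) n ∈ A.nil ^ (k + 1) := by
      rw [hn, map_sum]
      refine sum_mem fun i _ => ?_
      rw [← hn, hg.fderiv_evenSMul _ (hmem t), A.even_mul_comm (Subtype.prop _),
        Submodule.pow_succ]
      exact Submodule.mul_mem_mul (hd i _ (hmem t)) (U.nilProj_mem_nil A i z)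
    -- A linear functional killing `nil ^ (k + 1)` but not `g z` would be constant along the segment
    -- from `z0` to `z`, though it is zero at `z0`. This replaces integrating the derivative inside
    -- the subspace.
    by_contra hnot
    obtain ⟨L, hLz, hL⟩ := Submodule.exists_le_ker_of_notMem
      (p := (A.nil ^ (k + 1)).restrictScalars ℝ) hnot
    have hLd (t : ℝ) : HasDerivAt (fun t : ℝ => L (g (z0 + t • n))) 0 t := by
      have h1 := L.toContinuousLinearMap.hasFDerivAt.comp_hasDerivAt t (hder t)
      have h2 : L (fderiv ℝ g (z0 + t • n) n) = 0 := hL (hin t)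
      rw [← h2]
      exact h1
    have hc := is_const_of_deriv_eq_zero (fun t => (hLd t).differentiableAt)
      (fun t => (hLd t).deriv) 1 0
    have hz0' : g z0 = 0 := h0 _ (U.mem_coordDomain_iff.1 hz) _
    simp only [one_smul, zero_smul, add_zero, ← hzn, hz0', map_zero] at hc
    exact hLz hc

/-- A super smooth function vanishing at all points with real even coordinates vanishes. -/
theorem eq_zero (hg : U.IsSuperSmooth A g)
    (h0 : ∀ u ∈ U.carrier, ∀ ζ, g (U.realPoint u ζ) = 0) :
    ∀ z ∈ U.coordDomain A, g z = 0 := fun z hz =>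
  have ⟨K, hK⟩ := A.nil_pow_eq_zero
  hK _ (hg.mem_nil_pow K h0 z hz)

theorem eq_of_eq_realPoint (hg : U.IsSuperSmooth A g) (hh : U.IsSuperSmooth A h)
    (h0 : ∀ u ∈ U.carrier, ∀ ζ, g (U.realPoint u ζ) = h (U.realPoint u ζ)) :
    ∀ z ∈ U.coordDomain A, g z = h z := fun z hz =>
  sub_eq_zero.1 ((hg.sub hh).eq_zero (fun u hu ζ => sub_eq_zero.2 (h0 u hu ζ)) z hz)

end IsSuperSmooth

end Superdomain

/-- The `i`-th partial derivative. -/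
def partialDeriv {p : ℕ} (i : Fin p) (f : EuclideanSpace ℝ (Fin p) → ℝ) :
    EuclideanSpace ℝ (Fin p) → ℝ :=
  fun x => fderiv ℝ f x (EuclideanSpace.single i 1)

/-! ### Partial derivatives on open sets. -/

section PartialDeriv

variable {p : ℕ} {W : Opens (EuclideanSpace ℝ (Fin p))} {f g : EuclideanSpace ℝ (Fin p) → ℝ}

theorem contDiffOn_partialDeriv (i : Fin p) (hf : ContDiffOn ℝ ∞ f W) :
    ContDiffOn ℝ ∞ (partialDeriv i f) W :=
  (hf.fderiv_of_isOpen W.isOpen (by simp)).clm_apply contDiffOn_const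

theorem partialDeriv_congr (i : Fin p) (h : Set.EqOn f g W) :
    Set.EqOn (partialDeriv i f) (partialDeriv i g) W := fun x hx => by
  simp only [partialDeriv]
  rw [(Filter.eventuallyEq_of_mem (W.isOpen.mem_nhds hx) h).fderiv_eq]

theorem partialDeriv_comm (i j : Fin p) (hf : ContDiffOn ℝ ∞ f W) :
    Set.EqOn (partialDeriv i (partialDeriv j f)) (partialDeriv j (partialDeriv i f)) W := by
  intro x hx
  have hd : DifferentiableAt ℝ (fderiv ℝ f) x :=
    ((hf.fderiv_of_isOpen (m := ∞) W.isOpen (by simp)).contDiffAt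
      (W.isOpen.mem_nhds hx)).differentiableAt (by simp)
  have key (v w : EuclideanSpace ℝ (Fin p)) :
      fderiv ℝ (fun z => fderiv ℝ f z w) x v = fderiv ℝ (fderiv ℝ f) x v w := by
    rw [fderiv_clm_apply hd (differentiableAt_const w)]
    simp
  have symm := (hf.contDiffAt (W.isOpen.mem_nhds hx)).isSymmSndFDerivAt
      (by simpa using ENat.LEInfty.out)
  exact (key _ _).trans ((symm _ _).trans (key _ _).symm)

theorem fderiv_eq_sum_partialDeriv (x v : EuclideanSpace ℝ (Fin p)) :
    fderiv ℝ f x v = ∑ i, v i * partialDeriv i f x := by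
  have : v = ∑ i, v i • EuclideanSpace.single i (1 : ℝ) := by
    ext j
    simp [Pi.single_apply]
  conv_lhs => rw [this]
  simp [partialDeriv]

end PartialDeriv

/-! ### Taylor extension of smooth functions to `A`-points. -/

namespace Superdomain

variable (U : Superdomain) (A : SuperWeilAlgebra)

/-- The `k`-th homogeneous term (times `k!`) of the Taylor expansion of `f` at the real part of
a point of `A₀^p × A₁^q`, in the direction of its nilpotent part. -/
def taylorTerm : ℕ → (EuclideanSpace ℝ (Fin U.evenDim) → ℝ) → U.CoordSpace A → A.carrier
  | 0, f, z => algebraMap ℝ A.carrier (f (U.realPart A z))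
  | k + 1, f, z => ∑ i, U.nilProj A i z * taylorTerm k (partialDeriv i f) z

variable {A} {f g : EuclideanSpace ℝ (Fin U.evenDim) → ℝ}

theorem contDiffOn_taylorTerm (k : ℕ) (hf : ContDiffOn ℝ ∞ f U.carrier) :
    ContDiffOn ℝ ∞ (U.taylorTerm A k f) (U.coordDomain A) := by
  induction k generalizing f with
  | zero =>
    refine (Algebra.linearMap ℝ A.carrier).toContinuousLinearMap.contDiff.comp_contDiffOn
      (hf.comp (U.realPart A).contDiff.contDiffOn fun z hz => ?_)
    exact U.mem_coordDomain_iff.1 hz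
  | succ k ih =>
    exact ContDiffOn.sum fun i _ => (U.nilProj A i).contDiff.contDiffOn.mul
      (ih (contDiffOn_partialDeriv i hf))

theorem differentiableAt_taylorTerm (k : ℕ) (hf : ContDiffOn ℝ ∞ f U.carrier)
    {z : U.CoordSpace A} (hz : z ∈ U.coordDomain A) :
    DifferentiableAt ℝ (U.taylorTerm A k f) z :=
  ((U.contDiffOn_taylorTerm k hf).contDiffAt
    ((U.isOpen_coordDomain A).mem_nhds hz)).differentiableAt (by simp)

theorem taylorTerm_congr (k : ℕ) (h : Set.EqOn f g U.carrier) :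
    Set.EqOn (U.taylorTerm A k f) (U.taylorTerm A k g) (U.coordDomain A) := by
  induction k generalizing f g with
  | zero => intro z hz; simp only [taylorTerm, h (U.mem_coordDomain_iff.1 hz)]
  | succ k ih =>
    intro z hz
    simp only [taylorTerm]
    exact Finset.sum_congr rfl fun i _ => by rw [ih (partialDeriv_congr i h) hz]

theorem taylorTerm_mem_nil_pow (k : ℕ) (z : U.CoordSpace A) :
    U.taylorTerm A k f z ∈ A.nil ^ k := by
  induction k generalizing f with
  | zero => rw [Submodule.pow_zero, Ideal.one_eq_top]; trivial
  | succ k ih =>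
    refine sum_mem fun i _ => ?_
    rw [A.even_mul_comm (U.nilProj_mem_even A i z), Submodule.pow_succ]
    exact Submodule.mul_mem_mul ih (U.nilProj_mem_nil A i z)

theorem taylorTerm_mem_even (k : ℕ) (z : U.CoordSpace A) :
    U.taylorTerm A k f z ∈ A.grading 0 := by
  induction k generalizing f with
  | zero => exact A.algebraMap_mem_even _
  | succ k ih =>
    refine sum_mem fun i _ => ?_
    simpa using SetLike.mul_mem_graded (U.nilProj_mem_even A i z) ih

theorem taylorTerm_succ_realPoint (k : ℕ) (u : EuclideanSpace ℝ (Fin U.evenDim))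
    (ζ : Fin U.oddDim → A.grading 1) : U.taylorTerm A (k + 1) f (U.realPoint u ζ) = 0 := by
  simp [taylorTerm, nilProj_realPoint]

theorem fderiv_taylorTerm_zero (hf : ContDiffOn ℝ ∞ f U.carrier) {z : U.CoordSpace A}
    (hz : z ∈ U.coordDomain A) (v : U.CoordSpace A) :
    fderiv ℝ (U.taylorTerm A 0 f) z v =
      ∑ i, U.realPart A v i • U.taylorTerm A 0 (partialDeriv i f) z := by
  have hf' : DifferentiableAt ℝ f (U.realPart A z) :=
    (hf.contDiffAt (U.carrier.isOpen.mem_nhds (U.mem_coordDomain_iff.1 hz))).differentiableAt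
      (by simp)
  have h := ((Algebra.linearMap ℝ A.carrier).toContinuousLinearMap.hasFDerivAt.comp z
    (hf'.hasFDerivAt.comp z (U.realPart A).hasFDerivAt))
  have e : U.taylorTerm A 0 f = (Algebra.linearMap ℝ A.carrier).toContinuousLinearMap ∘
    f ∘ U.realPart A := rfl
  rw [e, h.fderiv]
  simp only [ContinuousLinearMap.comp_apply]
  rw [fderiv_eq_sum_partialDeriv, map_sum]
  refine Finset.sum_congr rfl fun i _ => ?_
  rw [← smul_eq_mul, map_smul]
  rfl

theorem fderiv_taylorTerm_succ_eq (k : ℕ) (hf : ContDiffOn ℝ ∞ f U.carrier) {z : U.CoordSpace A}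
    (hz : z ∈ U.coordDomain A) (v : U.CoordSpace A) :
    fderiv ℝ (U.taylorTerm A (k + 1) f) z v =
      ∑ i, U.nilProj A i v * U.taylorTerm A k (partialDeriv i f) z +
      ∑ i, U.nilProj A i z * fderiv ℝ (U.taylorTerm A k (partialDeriv i f)) z v := by
  have e : U.taylorTerm A (k + 1) f =
    fun z => ∑ i, U.nilProj A i z * U.taylorTerm A k (partialDeriv i f) z := rfl
  have hd (i) := U.differentiableAt_taylorTerm k (contDiffOn_partialDeriv i hf) hz
  rw [e, fderiv_fun_sum fun i _ => (U.nilProj A i).differentiableAt.fun_mul (hd i), sum_apply,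
    ← Finset.sum_add_distrib]
  refine Finset.sum_congr rfl fun i _ => ?_
  rw [fderiv_fun_mul' (U.nilProj A i).differentiableAt (hd i), (U.nilProj A i).fderiv]
  exact add_comm _ _

/-- Partial derivatives commute and the even coefficients `c j` are central, so the outer sum is
absorbed into the Taylor term of the next degree. -/
theorem sum_nilProj_mul_sum (k : ℕ) (hf : ContDiffOn ℝ ∞ f U.carrier) {z : U.CoordSpace A}
    (hz : z ∈ U.coordDomain A) (c : Fin U.evenDim → A.carrier) (hc : ∀ j, c j ∈ A.grading 0) :
    ∑ i, U.nilProj A i z * ∑ j, c j * U.taylorTerm A k (partialDeriv j (partialDeriv i f)) z =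
      ∑ j, c j * U.taylorTerm A (k + 1) (partialDeriv j f) z := by
  simp only [taylorTerm, Finset.mul_sum]
  rw [Finset.sum_comm]
  refine Finset.sum_congr rfl fun j _ => Finset.sum_congr rfl fun i _ => ?_
  rw [U.taylorTerm_congr k (partialDeriv_comm j i hf) hz, ← mul_assoc, ← mul_assoc,
    A.even_mul_comm (hc j)]

/-- Varying the real part differentiates the coefficients and keeps the degree. Varying the
nilpotent part lowers the degree by one; the term is a symmetric form on the diagonal, so its `k +
1` slots contribute equally. -/
theorem fderiv_taylorTerm_succ (k : ℕ) (hf : ContDiffOn ℝ ∞ f U.carrier) {z : U.CoordSpace A}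
    (hz : z ∈ U.coordDomain A) (v : U.CoordSpace A) :
    fderiv ℝ (U.taylorTerm A (k + 1) f) z v =
      ∑ i, U.realPart A v i • U.taylorTerm A (k + 1) (partialDeriv i f) z +
        (k + 1 : ℝ) • ∑ i, U.nilProj A i v * U.taylorTerm A k (partialDeriv i f) z := by
  have hreal (x : A.carrier) (i : Fin U.evenDim) :
      U.realPart A v i • x = algebraMap ℝ A.carrier (U.realPart A v i) * x :=
    Algebra.smul_def _ x
  induction k generalizing f with
  | zero =>
    simp only [U.fderiv_taylorTerm_succ_eq 0 hf hz,
      U.fderiv_taylorTerm_zero (contDiffOn_partialDeriv _ hf) hz, hreal]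
    rw [U.sum_nilProj_mul_sum 0 hf hz _ fun j => A.algebraMap_mem_even _, Nat.cast_zero,
      zero_add (1 : ℝ), one_smul, add_comm]
  | succ k ih =>
    simp only [U.fderiv_taylorTerm_succ_eq (k + 1) hf hz, ih (contDiffOn_partialDeriv _ hf),
      mul_add, Finset.sum_add_distrib, mul_smul_comm, hreal]
    rw [U.sum_nilProj_mul_sum (k + 1) hf hz _ fun j => A.algebraMap_mem_even _,
      ← Finset.smul_sum, U.sum_nilProj_mul_sum k hf hz _ fun j => U.nilProj_mem_even A j v]
    push_cast
    module

/-- The extension of a smooth function on `U` to `U_A` by its Taylor expansion. -/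
def weilExtension (f : EuclideanSpace ℝ (Fin U.evenDim) → ℝ) (z : U.CoordSpace A) : A.carrier :=
  ∑ k ∈ Finset.range (A.nil_pow_eq_zero.choose + 1), (k.factorial : ℝ)⁻¹ • U.taylorTerm A k f z

theorem weilExtension_mem_even (z : U.CoordSpace A) : U.weilExtension f z ∈ A.grading 0 :=
  sum_mem fun k _ => Submodule.smul_mem _ _ (U.taylorTerm_mem_even k z)

@[simp]
theorem weilExtension_realPoint (u : EuclideanSpace ℝ (Fin U.evenDim))
    (ζ : Fin U.oddDim → A.grading 1) :
    U.weilExtension f (U.realPoint u ζ) = algebraMap ℝ A.carrier (f u) := by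
  rw [weilExtension, Finset.sum_range_succ']
  simp only [taylorTerm_succ_realPoint]
  simp [taylorTerm]

theorem contDiffOn_weilExtension (hf : ContDiffOn ℝ ∞ f U.carrier) :
    ContDiffOn ℝ ∞ (U.weilExtension f) (U.coordDomain A) :=
  ContDiffOn.sum fun k _ => (U.contDiffOn_taylorTerm k hf).const_smul _

/-- The factors `1 / k!` cancel the multiplicities in the nilpotent direction, so the real and
nilpotent parts of `v` recombine into its full even coordinates. The result is visibly `A₀`-linear
in `v`. -/
theorem fderiv_weilExtension (hf : ContDiffOn ℝ ∞ f U.carrier) {z : U.CoordSpace A}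
    (hz : z ∈ U.coordDomain A) (v : U.CoordSpace A) :
    fderiv ℝ (U.weilExtension f) z v =
      ∑ i, U.evenProj A i v * U.weilExtension (partialDeriv i f) z := by
  set K := A.nil_pow_eq_zero.choose with hK
  -- The nilpotent direction shifts the degree down and so only produces degrees below `K`; nothing
  -- is lost, because the degree `K` term lies in `nil ^ K = 0`.
  have hlast (i : Fin U.evenDim) : U.taylorTerm A K (partialDeriv i f) z = 0 :=
    A.nil_pow_eq_zero.choose_spec _ (U.taylorTerm_mem_nil_pow K z)
  have hext (i : Fin U.evenDim) : U.weilExtension (partialDeriv i f) z =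
      ∑ k ∈ Finset.range K, (k.factorial : ℝ)⁻¹ • U.taylorTerm A k (partialDeriv i f) z := by
    rw [weilExtension, Finset.sum_range_succ, ← hK, hlast, smul_zero, add_zero]
  have hsplit (i : Fin U.evenDim) : U.evenProj A i v * U.weilExtension (partialDeriv i f) z =
      U.realPart A v i • U.weilExtension (partialDeriv i f) z +
      U.nilProj A i v * U.weilExtension (partialDeriv i f) z := by
    rw [Algebra.smul_def, ← add_mul, nilProj_apply]
    simp
  have e : U.weilExtension (A := A) f = fun z => ∑ k ∈ Finset.range (K + 1),
    (k.factorial : ℝ)⁻¹ • U.taylorTerm A k f z := rfl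
  have hd (k : ℕ) := U.differentiableAt_taylorTerm k hf hz
  rw [e, fderiv_fun_sum fun k _ => (hd k).fun_const_smul _, sum_apply]
  simp only [hsplit, Finset.sum_add_distrib]
  have hk (k : ℕ) : fderiv ℝ (fun z => (k.factorial : ℝ)⁻¹ • U.taylorTerm A k f z) z v =
      (k.factorial : ℝ)⁻¹ • fderiv ℝ (U.taylorTerm A k f) z v := by
    rw [fderiv_fun_const_smul (hd k)]; rfl
  have hfac (k : ℕ) : ((k + 1).factorial : ℝ)⁻¹ * (k + 1 : ℝ) = (k.factorial : ℝ)⁻¹ := by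
    rw [Nat.factorial_succ]
    have : (k.factorial : ℝ) ≠ 0 := Nat.cast_ne_zero.2 k.factorial_ne_zero
    push_cast
    field_simp
  simp only [hk]
  rw [Finset.sum_range_succ']
  simp only [U.fderiv_taylorTerm_succ _ hf hz, U.fderiv_taylorTerm_zero hf hz, smul_add,
    Finset.sum_add_distrib, smul_smul, hfac]
  rw [add_right_comm, ← Finset.sum_range_succ'
    (fun k => (k.factorial : ℝ)⁻¹ • ∑ i, U.realPart A v i • U.taylorTerm A k (partialDeriv i f) z)]
  congr 1
  · simp only [weilExtension, Finset.smul_sum]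
    rw [Finset.sum_comm]
    refine Finset.sum_congr rfl fun i _ => Finset.sum_congr rfl fun k _ => smul_comm _ _ _
  · simp only [hext, Finset.mul_sum, Finset.smul_sum, mul_smul_comm]
    rw [Finset.sum_comm]

theorem isSuperSmooth_weilExtension (hf : ContDiffOn ℝ ∞ f U.carrier) :
    U.IsSuperSmooth A (U.weilExtension f) :=
  ⟨U.contDiffOn_weilExtension hf, fun z hz a v => by
    rw [U.fderiv_weilExtension hf hz, U.fderiv_weilExtension hf hz, Finset.mul_sum]
    exact Finset.sum_congr rfl fun i _ => mul_assoc _ _ _⟩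

end Superdomain

/-! ### Hadamard's lemma. -/

section Hadamard

open MeasureTheory

/-- The integral is the convolution at `0` of the indicator of `(0, 1]` with `s ↦ χ s * h (-s • x)`,
where `x` is a parameter. The cutoff `χ` supplies the compact support needed for smooth dependence
on `x` and equals one where it matters. -/
theorem contDiff_integral_comp_smul {E : Type*} [NormedAddCommGroup E] [NormedSpace ℝ E]
    {h : E → ℝ} (hh : ContDiff ℝ ∞ h) : ContDiff ℝ ∞ fun x => ∫ t in (0 : ℝ)..1, h (t • x) := by
  let χ : ContDiffBump (0 : ℝ) := ⟨1, 2, one_pos, one_lt_two⟩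
  let f : ℝ → ℝ := Set.indicator (Set.Ioc 0 1) 1
  let g : E → ℝ → ℝ := fun p s => χ s * h ((-s) • p)
  have hf : LocallyIntegrable f volume :=
    ((integrable_indicator_iff measurableSet_Ioc).2
      (integrableOn_const (C := (1 : ℝ)) (by simp))).locallyIntegrable
  have hg : ContDiff ℝ ∞ (fun q : E × ℝ => χ q.2 * h ((-q.2) • q.1)) :=
    (χ.contDiff.comp contDiff_snd).mul (hh.comp (contDiff_snd.neg.smul contDiff_fst))
  have key := contDiffOn_convolution_right_with_param_comp (𝕜 := ℝ) (n := ⊤) (μ := volume)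
    (ContinuousLinearMap.lsmul ℝ ℝ) (s := Set.univ) (v := fun _ : E => (0 : ℝ)) (f := f) (g := g)
    (k := Metric.closedBall 0 2) contDiffOn_const isOpen_univ (isCompact_closedBall _ _)
    (fun p x _ hx => by
      have : χ x = 0 := χ.zero_of_le_dist (by
        rw [Metric.mem_closedBall, not_le] at hx; exact hx.le)
      simp [g, this]) hf hg.contDiffOn
  rw [contDiffOn_univ] at key
  convert! key using 2 with x
  rw [convolution_def, intervalIntegral.integral_of_le zero_le_one, ← integral_indicator
    measurableSet_Ioc]
  congr 1
  ext t
  by_cases ht : t ∈ Set.Ioc (0 : ℝ) 1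
  · have : χ (-t) = 1 := χ.one_of_mem_closedBall (by
      simpa [abs_of_pos ht.1] using ht.2)
    simp [f, g, ht, this]
  · simp [f, ht]

/-- Hadamard's lemma for functions smooth on the whole space. -/
theorem exists_eq_add_sum_mul_of_contDiff {p : ℕ} {f : EuclideanSpace ℝ (Fin p) → ℝ}
    (hf : ContDiff ℝ ∞ f) (u : EuclideanSpace ℝ (Fin p)) :
    ∃ g : Fin p → EuclideanSpace ℝ (Fin p) → ℝ, (∀ i, ContDiff ℝ ∞ (g i)) ∧
      ∀ x, f x = f u + ∑ i, (x i - u i) * g i x := by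
  have hd (i : Fin p) : ContDiff ℝ ∞ fun y => partialDeriv i f (u + y) :=
    ((hf.fderiv_right (m := ∞) (by simp)).clm_apply contDiff_const).comp
      (contDiff_const.add contDiff_id)
  refine ⟨fun i x => ∫ t in (0 : ℝ)..1, partialDeriv i f (u + t • (x - u)),
    fun i => (contDiff_integral_comp_smul (hd i)).comp (contDiff_id.sub contDiff_const),
    fun x => ?_⟩
  have hc (i : Fin p) : Continuous fun t : ℝ => partialDeriv i f (u + t • (x - u)) :=
    (hd i).continuous.comp (continuous_id.smul continuous_const)
  have hder (t : ℝ) : HasDerivAt (fun t : ℝ => f (u + t • (x - u)))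
      (∑ i, (x i - u i) * partialDeriv i f (u + t • (x - u))) t := by
    have hl : HasDerivAt (fun t : ℝ => u + t • (x - u)) (x - u) t := by
      simpa using ((hasDerivAt_id t).smul_const (x - u)).const_add u
    have h := (hf.differentiable (by simp) _).hasFDerivAt.comp_hasDerivAt t hl
    rw [fderiv_eq_sum_partialDeriv] at h
    exact h
  have hftc := intervalIntegral.integral_eq_sub_of_hasDerivAt (a := 0) (b := 1)
    (fun t _ => hder t) (Continuous.intervalIntegrable
      (continuous_finsetSum _ fun i _ => continuous_const.mul (hc i)) _ _)
  rw [intervalIntegral.integral_finsetSum fun i _ =>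
    ((hc i).const_mul _).intervalIntegrable _ _] at hftc
  simp only [intervalIntegral.integral_const_mul, one_smul, zero_smul, add_zero,
    add_sub_cancel] at hftc
  rw [hftc]
  ring

/-- Hadamard's lemma on an arbitrary open set. -/
theorem exists_eq_add_sum_mul {p : ℕ} {W : Opens (EuclideanSpace ℝ (Fin p))}
    {f : EuclideanSpace ℝ (Fin p) → ℝ} (hf : ContDiffOn ℝ ∞ f W)
    {u : EuclideanSpace ℝ (Fin p)} (hu : u ∈ W) :
    ∃ g : Fin p → EuclideanSpace ℝ (Fin p) → ℝ, (∀ i, ContDiffOn ℝ ∞ (g i) W) ∧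
      ∀ x ∈ W, f x = f u + ∑ i, (x i - u i) * g i x := by
  obtain ⟨r, hr, hball⟩ := Metric.isOpen_iff.1 W.isOpen u hu
  -- Since `W` need not be star-shaped about `u`, the function is split: `φ f` extends smoothly to
  -- the whole space, while `f - φ f` vanishes near `u` and may be divided by `‖x - u‖ ^ 2 = ∑ (x i
  -- - u i) ^ 2`.
  let φ : ContDiffBump u := ⟨r / 4, r / 2, by positivity, by linarith⟩
  have hφf : ContDiff ℝ ∞ fun x => φ x * f x := by
    rw [contDiff_iff_contDiffAt]
    intro x
    by_cases hx : x ∈ W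
    · exact φ.contDiff.contDiffAt.mul (hf.contDiffAt (W.isOpen.mem_nhds hx))
    · have hx' : x ∉ tsupport φ := fun h => hx (hball (by
        rw [φ.tsupport_eq] at h
        exact Metric.closedBall_subset_ball (by simp only [φ]; linarith) h))
      have h0 : (fun x => φ x * f x) =ᶠ[nhds x] fun _ => 0 := by
        filter_upwards [notMem_tsupport_iff_eventuallyEq.1 hx'] with y hy
        simp [hy]
      exact contDiffAt_const.congr_of_eventuallyEq h0
  obtain ⟨g, hg, hfg⟩ := exists_eq_add_sum_mul_of_contDiff hφf u
  have hone : φ =ᶠ[nhds u] 1 := φ.eventuallyEq_one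
  let Q : EuclideanSpace ℝ (Fin p) → ℝ := fun x => (f x - φ x * f x) / ‖x - u‖ ^ 2
  have hQ : ContDiffOn ℝ ∞ Q W := by
    intro x hx
    refine ContDiffAt.contDiffWithinAt ?_
    by_cases hxu : x = u
    · subst hxu
      have h0 : Q =ᶠ[nhds x] fun _ => 0 := by
        filter_upwards [hone] with y hy
        simp [Q, hy]
      exact contDiffAt_const.congr_of_eventuallyEq h0
    · have hne : ‖x - u‖ ^ 2 ≠ 0 := by
        simpa [sub_eq_zero] using hxu
      exact ((hf.contDiffAt (W.isOpen.mem_nhds hx)).sub hφf.contDiffAt).div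
        ((contDiff_id.sub contDiff_const).norm_sq ℝ).contDiffAt hne
  have hcoord (i : Fin p) : ContDiff ℝ ∞ fun x : EuclideanSpace ℝ (Fin p) => x i :=
    contDiff_piLp_apply 2
  refine ⟨fun i x => g i x + (x i - u i) * Q x, fun i => (hg i).contDiffOn.add
    (((hcoord i).sub contDiff_const).contDiffOn.mul hQ), fun x hx => ?_⟩
  have h1 : φ u = 1 := hone.eq_of_nhds
  have h2 := hfg x
  simp only [h1, one_mul] at h2
  have h3 : f x - φ x * f x = ∑ i, (x i - u i) * ((x i - u i) * Q x) := by
    by_cases hxu : x = u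
    · subst hxu; simp [h1]
    · have hne : ‖x - u‖ ^ 2 ≠ 0 := by
        simpa [sub_eq_zero] using hxu
      have hnorm : ∑ i, (x i - u i) * (x i - u i) = ‖x - u‖ ^ 2 := by
        rw [EuclideanSpace.norm_sq_eq]
        exact Finset.sum_congr rfl fun i _ => by simp [sq]
      simp only [← mul_assoc]
      rw [← Finset.sum_mul, hnorm, mul_div_cancel₀ _ hne]
  simp only [mul_add, Finset.sum_add_distrib]
  rw [← h3, ← add_assoc, ← h2]
  ring

end Hadamard

/-! ### Characters and Weil-algebra-valued morphisms of smooth functions. -/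

section SmoothFun

variable {p : ℕ} {W : Opens (EuclideanSpace ℝ (Fin p))}

/-- Extension of a smooth function on `W` by zero. -/
def extendFun (f : SmoothFun p W) : EuclideanSpace ℝ (Fin p) → ℝ :=
  Function.extend Subtype.val f 0

@[simp]
theorem extendFun_coe (f : SmoothFun p W) (x : W) : extendFun f x = f x :=
  Subtype.val_injective.extend_apply _ _ _

theorem contDiffOn_extendFun (f : SmoothFun p W) : ContDiffOn ℝ ∞ (extendFun f) W := by
  intro x hx
  refine ContDiffAt.contDiffWithinAt (contMDiffAt_iff_contDiffAt.1 ?_)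
  refine (contMDiffAt_subtype_iff (U := W) (x := ⟨x, hx⟩)).1 ?_
  simp only [extendFun_coe]
  exact f.contMDiff _

/-- The smooth function on `W` given by a function on the ambient space which is smooth on `W`. -/
def smoothFunOfContDiffOn (g : EuclideanSpace ℝ (Fin p) → ℝ) (hg : ContDiffOn ℝ ∞ g W) :
    SmoothFun p W :=
  ⟨fun x => g x, fun x => contMDiffAt_subtype_iff.2
    (hg.contDiffAt (W.isOpen.mem_nhds x.2)).contMDiffAt⟩

@[simp]
theorem smoothFunOfContDiffOn_apply (g : EuclideanSpace ℝ (Fin p) → ℝ)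
    (hg : ContDiffOn ℝ ∞ g W) (x : W) : smoothFunOfContDiffOn g hg x = g x :=
  rfl

/-- The `i`-th coordinate function on `W`. -/
def coordFun (i : Fin p) : SmoothFun p W :=
  smoothFunOfContDiffOn (fun x => x i) (contDiff_piLp_apply 2).contDiffOn

@[simp]
theorem coordFun_apply (i : Fin p) (x : W) :
    (coordFun i : SmoothFun p W) x = (x : EuclideanSpace ℝ (Fin p)) i :=
  rfl

theorem isUnit_smoothFun {f : SmoothFun p W} (hf : ∀ x, f x ≠ 0) : IsUnit f := by
  have h : ContDiffOn ℝ ∞ (fun x => (extendFun f x)⁻¹) W :=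
    (contDiffOn_extendFun f).inv fun x hx => by
      have := hf ⟨x, hx⟩
      rwa [← extendFun_coe] at this
  refine IsUnit.of_mul_eq_one (smoothFunOfContDiffOn _ h) ?_
  ext x
  simp [hf x]

/-- Every character of the algebra of smooth functions is the evaluation at a point. -/
theorem exists_eq_eval (χ : SmoothFun p W →ₐ[ℝ] ℝ) :
    ∃ x : W, ∀ f, χ f = f x := by
  let u : EuclideanSpace ℝ (Fin p) := WithLp.toLp 2 fun i => χ (coordFun i)
  have key (f : SmoothFun p W) : ∃ x : W, (x : EuclideanSpace ℝ (Fin p)) = u ∧ χ f = f x := by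
    -- A sum of squares killed by `χ` is not a unit, hence has a zero in `W`; there every square
    -- vanishes, so the point is `u` and the value of `f` is `χ f`.
    let g : SmoothFun p W := (f - algebraMap ℝ _ (χ f)) ^ 2 +
      ∑ i, (coordFun i - algebraMap ℝ _ (u i)) ^ 2
    have hg : χ g = 0 := by simp [g, u]
    have happ (x : W) : g x = (f x - χ f) ^ 2 +
        ∑ i, ((x : EuclideanSpace ℝ (Fin p)) i - u i) ^ 2 := by
      have := map_add (evalFun p x) ((f - algebraMap ℝ _ (χ f)) ^ 2)
        (∑ i, (coordFun i - algebraMap ℝ _ (u i)) ^ 2)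
      simp only [map_sum, map_pow, map_sub, AlgHom.commutes] at this
      exact this
    have hnot : ¬ ∀ x, g x ≠ 0 := fun h => by
      have := (isUnit_smoothFun h).map χ
      rw [hg] at this
      exact not_isUnit_zero this
    push Not at hnot
    obtain ⟨x, hx⟩ := hnot
    rw [happ] at hx
    have hsum : 0 ≤ ∑ i, ((x : EuclideanSpace ℝ (Fin p)) i - u i) ^ 2 :=
      Finset.sum_nonneg fun i _ => sq_nonneg _
    have h1 : (f x - χ f) ^ 2 = 0 := by nlinarith [sq_nonneg (f x - χ f)]
    have h2 : ∑ i, ((x : EuclideanSpace ℝ (Fin p)) i - u i) ^ 2 = 0 := by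
      nlinarith [sq_nonneg (f x - χ f)]
    refine ⟨x, ?_, ?_⟩
    · ext i
      have := (Finset.sum_eq_zero_iff_of_nonneg fun i _ => sq_nonneg _).1 h2 i (Finset.mem_univ i)
      exact sub_eq_zero.1 (pow_eq_zero_iff two_ne_zero |>.1 this)
    · exact (sub_eq_zero.1 (pow_eq_zero_iff two_ne_zero |>.1 h1)).symm
  -- Any `f` serves to show that `u` lies in `W`; afterwards the zeros found for different `f` all
  -- coincide with it.
  obtain ⟨x, hx, -⟩ := key 0
  refine ⟨x, fun f => ?_⟩
  obtain ⟨y, hy, hf⟩ := key f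
  rw [hf, Subtype.ext (hy.trans hx.symm)]

theorem exists_smoothFun_hadamard (f : SmoothFun p W) (x : W) :
    ∃ g : Fin p → SmoothFun p W, f = algebraMap ℝ _ (f x) +
      ∑ i, (coordFun i - algebraMap ℝ _ ((x : EuclideanSpace ℝ (Fin p)) i)) * g i := by
  obtain ⟨g, hg, hfg⟩ := exists_eq_add_sum_mul (contDiffOn_extendFun f) x.2
  refine ⟨fun i => smoothFunOfContDiffOn (g i) (hg i), ?_⟩
  ext y
  have := map_add (evalFun p y) (algebraMap ℝ _ (f x)) (∑ i, (coordFun i -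
    algebraMap ℝ _ ((x : EuclideanSpace ℝ (Fin p)) i)) * smoothFunOfContDiffOn (g i) (hg i))
  simp only [map_sum, map_mul, map_sub, AlgHom.commutes] at this
  refine Eq.trans ?_ this.symm
  have h := hfg y y.2
  rw [extendFun_coe, extendFun_coe] at h
  exact h

/-- A morphism from smooth functions to a super Weil algebra is determined by the images of the
coordinates. -/
theorem smoothFun_algHom_ext {A : SuperWeilAlgebra} {x y : SmoothFun p W →ₐ[ℝ] A.carrier}
    (h : ∀ i, x (coordFun i) = y (coordFun i)) : x = y := by
  obtain ⟨u, hu⟩ := exists_eq_eval (A.body.comp x)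
  obtain ⟨v, hv⟩ := exists_eq_eval (A.body.comp y)
  have huv : u = v := by
    refine Subtype.ext (PiLp.ext fun i => ?_)
    have h1 := hu (coordFun i)
    have h2 := hv (coordFun i)
    rw [AlgHom.comp_apply, h i] at h1
    exact h1.symm.trans h2
  subst huv
  -- Hadamard's lemma at the common real point `u` writes `x f - y f` as a sum of differences `x g -
  -- y g` times nilpotents, gaining one power of `nil` per step.
  have key (k : ℕ) : ∀ f, x f - y f ∈ A.nil ^ k := by
    induction k with
    | zero => intro f; rw [Submodule.pow_zero, Ideal.one_eq_top]; trivial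
    | succ k ih =>
      intro f
      obtain ⟨g, hg⟩ := exists_smoothFun_hadamard f u
      have hxy : x f - y f = ∑ i, (x (g i) - y (g i)) *
          (y (coordFun i) - algebraMap ℝ _ ((u : EuclideanSpace ℝ (Fin p)) i)) := by
        conv_lhs => rw [hg]
        simp only [map_add, map_sum, AlgHom.commutes, add_sub_add_left_eq_sub,
          ← Finset.sum_sub_distrib]
        refine Finset.sum_congr rfl fun i _ => ?_
        rw [mul_comm _ (g i)]
        simp only [map_mul, map_sub, AlgHom.commutes, h, sub_mul]
      rw [hxy]
      refine sum_mem fun i _ => ?_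
      rw [Submodule.pow_succ]
      refine Submodule.mul_mem_mul (ih (g i)) ?_
      rw [← A.body_eq_iff]
      exact hv (coordFun i)
  obtain ⟨K, hK⟩ := A.nil_pow_eq_zero
  ext f
  exact sub_eq_zero.1 (hK _ (key K f))

end SmoothFun

/-! ### Parity in Grassmann algebras and in sections. -/

section Grassmann

/-- The part of parity `i` is spanned by products of `n ≡ i` generators, and a product of `n` odd
elements has parity `n`. -/
theorem map_mem_of_ι_mem {q : ℕ} {B : Type*} [Ring B] [Algebra ℝ B] (ℬ : ZMod 2 → Submodule ℝ B)
    [SetLike.GradedMonoid ℬ] (f : Grassmann q →ₐ[ℝ] B)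
    (hf : ∀ m, f (ExteriorAlgebra.ι ℝ m) ∈ ℬ 1) {i : ZMod 2} {a : Grassmann q}
    (ha : a ∈ grassmannGrading q i) : f a ∈ ℬ i := by
  induction ha using Submodule.iSup_induction' with
  | mem n x hx =>
    obtain ⟨n, rfl⟩ := n
    dsimp only at hx ⊢
    induction hx using Submodule.pow_induction_on_left' with
    | algebraMap r => rw [AlgHom.commutes, Nat.cast_zero]; exact SetLike.algebraMap_mem_graded _ _
    | add x y n _ _ hx hy => rw [map_add]; exact add_mem hx hy
    | mem_mul m hm n x _ hx =>
      obtain ⟨m, rfl⟩ := hm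
      rw [map_mul, Nat.succ_eq_add_one, Nat.cast_add, Nat.cast_one, add_comm]
      exact SetLike.mul_mem_graded (hf m) hx
  | zero => simp
  | add x y _ _ hx hy => rw [map_add]; exact add_mem hx hy

theorem sectionsGrading_induction {p q : ℕ} {W : Opens (EuclideanSpace ℝ (Fin p))} {i : ZMod 2}
    {motive : Sections p q W → Prop}
    (tmul : ∀ (f : SmoothFun p W), ∀ l ∈ grassmannGrading q i, motive (f ⊗ₜ l))
    (zero : motive 0) (add : ∀ s t, motive s → motive t → motive (s + t))
    {s : Sections p q W} (hs : s ∈ sectionsGrading p q W i) : motive s := by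
  -- `motive` is not assumed stable under smooth scalars, so the span induction carries an arbitrary
  -- scalar until a pure tensor absorbs it.
  have h : ∀ c : SmoothFun p W, motive (c • s) := by
    change s ∈ (grassmannGrading q i).baseChange (SmoothFun p W) at hs
    rw [Submodule.baseChange_eq_span] at hs
    induction hs using Submodule.span_induction with
    | mem y hy =>
      obtain ⟨t, ht, rfl⟩ := hy
      intro c
      rw [TensorProduct.mk_apply, TensorProduct.smul_tmul', smul_eq_mul, mul_one]
      exact tmul c t ht
    | zero => intro c; rwa [smul_zero]
    | add y z _ _ hy hz => intro c; rw [smul_add]; exact add _ _ (hy c) (hz c)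
    | smul d y _ hy => intro c; rw [smul_smul]; exact hy _
  simpa using h 1

theorem tmul_mem_sectionsGrading {p q : ℕ} {W : Opens (EuclideanSpace ℝ (Fin p))} {i : ZMod 2}
    (f : SmoothFun p W) {l : Grassmann q} (hl : l ∈ grassmannGrading q i) :
    f ⊗ₜ[ℝ] l ∈ sectionsGrading p q W i :=
  Submodule.tmul_mem_baseChange_of_mem _ hl

end Grassmann

/-! ### `A`-points and their coordinates. -/

namespace Superdomain

variable (U : Superdomain) {A : SuperWeilAlgebra}

/-- The morphism from the Grassmann algebra sending the generators to given odd elements. -/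
def oddEval {q : ℕ} (ζ : Fin q → A.grading 1) : Grassmann q →ₐ[ℝ] A.carrier :=
  ExteriorAlgebra.lift ℝ ⟨Fintype.linearCombination ℝ fun j => (ζ j : A.carrier), fun m =>
    A.odd_mul_self (by
      rw [Fintype.linearCombination_apply]
      exact sum_mem fun j _ => Submodule.smul_mem _ _ (ζ j).2)⟩

theorem oddEval_ι {q : ℕ} (ζ : Fin q → A.grading 1) (m : Fin q → ℝ) :
    oddEval ζ (ExteriorAlgebra.ι ℝ m) = ∑ j, m j • (ζ j : A.carrier) := by
  rw [oddEval, ExteriorAlgebra.lift_ι_apply, Fintype.linearCombination_apply]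

theorem oddEval_mem {q : ℕ} (ζ : Fin q → A.grading 1) {i : ZMod 2} {l : Grassmann q}
    (hl : l ∈ grassmannGrading q i) : oddEval ζ l ∈ A.grading i :=
  map_mem_of_ι_mem A.grading _ (fun m => by
    rw [oddEval_ι]; exact sum_mem fun j _ => Submodule.smul_mem _ _ (ζ j).2) hl

theorem isSuperSmooth_oddEval (l : Grassmann U.oddDim) :
    U.IsSuperSmooth A fun z => oddEval z.2 l := by
  induction l using ExteriorAlgebra.induction with
  | algebraMap r => simpa using .const _
  | ι m =>
    simp only [oddEval_ι, Algebra.smul_def]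
    exact .sum _ fun j _ => (IsSuperSmooth.const _).mul (.oddProj j)
  | mul a b ha hb => simpa using ha.mul hb
  | add a b ha hb => simpa using ha.add hb

/-- Evaluation of smooth functions at a point of `U_A`. -/
def evalSmooth (z : U.CoordSpace A) (hz : z ∈ U.coordDomain A) :
    SmoothFun U.evenDim U.carrier →ₐ[ℝ] A.carrier :=
  have hs (f : SmoothFun U.evenDim U.carrier) :=
    U.isSuperSmooth_weilExtension (A := A) (contDiffOn_extendFun f)
  have happ (f : SmoothFun U.evenDim U.carrier) {u} (hu : u ∈ U.carrier) :
      extendFun f u = f ⟨u, hu⟩ := extendFun_coe f ⟨u, hu⟩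
  -- Each algebra law is an equality of super smooth functions of `z` that is clear at points with
  -- real even coordinates, so rigidity replaces any manipulation of Taylor sums.
  AlgHom.ofLinearMap
    { toFun := fun f => U.weilExtension (extendFun f) z
      map_add' := fun f g => by
        refine (hs (f + g)).eq_of_eq_realPoint ((hs f).add (hs g)) (fun u hu ζ => ?_) z hz
        simp only [weilExtension_realPoint, happ _ hu, ← map_add]
        rfl
      map_smul' := fun c f => by
        rw [RingHom.id_apply]
        refine Eq.trans ?_ (Algebra.smul_def c (U.weilExtension (extendFun f) z)).symm
        refine (hs (c • f)).eq_of_eq_realPoint ((IsSuperSmooth.const _).mul (hs f))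
          (fun u hu ζ => ?_) z hz
        simp only [weilExtension_realPoint, happ _ hu, ← map_mul]
        rfl }
    (by
      refine (hs 1).eq_of_eq_realPoint (.const 1) (fun u hu ζ => ?_) z hz
      rw [weilExtension_realPoint, happ _ hu, ← map_one (algebraMap ℝ A.carrier)]
      rfl)
    (fun f g => by
      refine (hs (f * g)).eq_of_eq_realPoint ((hs f).mul (hs g)) (fun u hu ζ => ?_) z hz
      simp only [weilExtension_realPoint, happ _ hu, ← map_mul]
      rfl)

theorem evalSmooth_coordFun (z : U.CoordSpace A) (hz : z ∈ U.coordDomain A) (i : Fin U.evenDim) :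
    U.evalSmooth z hz (coordFun i) = z.1 i :=
  (U.isSuperSmooth_weilExtension (contDiffOn_extendFun _)).eq_of_eq_realPoint (.evenProj i)
    (fun u hu ζ => by
      rw [weilExtension_realPoint, extendFun_coe (coordFun i) ⟨u, hu⟩]
      rfl) z hz

/-- The `A`-point with given coordinates. -/
def evalPoint (z : U.CoordSpace A) (hz : z ∈ U.coordDomain A) :
    U.globalSections →ₐᵍ[ℝ] A.grading :=
  { Algebra.TensorProduct.lift (U.evalSmooth z hz) (oddEval z.2) (fun f _ =>
      A.even_mul_comm (U.weilExtension_mem_even (f := extendFun f) z) _) with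
    map_mem := by
      intro i s hs
      refine sectionsGrading_induction (motive := fun s =>
        Algebra.TensorProduct.lift (U.evalSmooth z hz) (oddEval z.2) (fun f _ =>
          A.even_mul_comm (U.weilExtension_mem_even (f := extendFun f) z) _) s ∈ A.grading i)
        (fun f l hl => ?_) ?_ (fun s t hs ht => ?_) hs
      · have := SetLike.mul_mem_graded (U.weilExtension_mem_even (f := extendFun f) z)
          (oddEval_mem z.2 hl)
        rw [zero_add] at this
        exact this
      · rw [map_zero]; exact zero_mem _
      · rw [map_add]; exact add_mem hs ht }

theorem evalPoint_tmul (z : U.CoordSpace A) (hz : z ∈ U.coordDomain A)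
    (f : SmoothFun U.evenDim U.carrier) (l : Grassmann U.oddDim) :
    U.evalPoint z hz (f ⊗ₜ l) = U.weilExtension (extendFun f) z * oddEval z.2 l :=
  rfl

theorem coords_evalPoint (z : U.CoordSpace A) (hz : z ∈ U.coordDomain A) :
    U.coords (A := A) (U.evalPoint z hz) = z := by
  ext j
  · change U.evalSmooth z hz (coordFun j) * oddEval z.2 1 = _
    rw [map_one, mul_one, evalSmooth_coordFun]
  · change U.evalSmooth z hz 1 * oddEval z.2 (ExteriorAlgebra.ι ℝ _) = _
    rw [map_one, one_mul, oddEval_ι]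
    simp [Pi.single_apply]

/-- The even part of an `A`-point. -/
def evenRestriction (x : U.globalSections →ₐᵍ[ℝ] A.grading) :
    SmoothFun U.evenDim U.carrier →ₐ[ℝ] A.carrier :=
  x.toAlgHom.comp Algebra.TensorProduct.includeLeft

theorem coords_mem_coordDomain (x : U.globalSections →ₐᵍ[ℝ] A.grading) :
    U.coords (A := A) x ∈ U.coordDomain A := by
  obtain ⟨u, hu⟩ := exists_eq_eval (A.body.comp (U.evenRestriction x))
  refine ⟨u, u.2, fun i => ?_⟩
  rw [← A.body_eq_iff]
  exact hu (coordFun i)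

/-- On smooth functions this is `smoothFun_algHom_ext`; on the Grassmann factor a morphism is fixed
by the generators. -/
theorem point_ext {x y : U.globalSections →ₐᵍ[ℝ] A.grading}
    (h : U.coords (A := A) x = U.coords (A := A) y) : x = y := by
  have heven : U.evenRestriction x = U.evenRestriction y :=
    smoothFun_algHom_ext fun i => congrArg Subtype.val (congrFun (congrArg Prod.fst h) i)
  have hodd : x.toAlgHom.comp Algebra.TensorProduct.includeRight =
      y.toAlgHom.comp (Algebra.TensorProduct.includeRight :
        Grassmann U.oddDim →ₐ[ℝ] Sections U.evenDim U.oddDim U.carrier) := by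
    refine ExteriorAlgebra.hom_ext (LinearMap.pi_ext' fun j => LinearMap.ext_ring ?_)
    exact congrArg Subtype.val (congrFun (congrArg Prod.snd h) j)
  have : x.toAlgHom = y.toAlgHom := Algebra.TensorProduct.ext heven hodd
  ext s
  exact DFunLike.congr_fun this s

theorem evalPoint_coords (x : U.globalSections →ₐᵍ[ℝ] A.grading) :
    U.evalPoint (U.coords (A := A) x) (U.coords_mem_coordDomain x) = x :=
  U.point_ext (U.coords_evalPoint _ _)

open Classical in
/-- A global section as an `A`-valued function on `U_A`. -/
def evalSection (s : Sections U.evenDim U.oddDim U.carrier) (z : U.CoordSpace A) : A.carrier :=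
  if hz : z ∈ U.coordDomain A then U.evalPoint z hz s else 0

theorem evalSection_of_mem (s : Sections U.evenDim U.oddDim U.carrier) {z : U.CoordSpace A}
    (hz : z ∈ U.coordDomain A) : U.evalSection s z = U.evalPoint z hz s :=
  dif_pos hz

theorem isSuperSmooth_evalSection (s : Sections U.evenDim U.oddDim U.carrier) :
    U.IsSuperSmooth A (U.evalSection s) := by
  induction s using TensorProduct.induction_on with
  | zero => exact (IsSuperSmooth.const 0).congr fun z hz => by simp [evalSection]
  | tmul f l =>
    exact ((U.isSuperSmooth_weilExtension (contDiffOn_extendFun f)).mul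
      (U.isSuperSmooth_oddEval l)).congr fun z hz => by
        rw [U.evalSection_of_mem _ hz, evalPoint_tmul]
  | add s t hs ht =>
    exact (hs.add ht).congr fun z hz => by
      simp only [U.evalSection_of_mem _ hz, map_add]

theorem evalSection_coords (s : Sections U.evenDim U.oddDim U.carrier)
    (x : U.globalSections →ₐᵍ[ℝ] A.grading) : U.evalSection s (U.coords (A := A) x) = x s := by
  rw [U.evalSection_of_mem _ (U.coords_mem_coordDomain x), evalPoint_coords]

theorem evalSection_mem {i : ZMod 2} {s : Sections U.evenDim U.oddDim U.carrier}
    (hs : s ∈ U.globalSections i) (z : U.CoordSpace A) : U.evalSection s z ∈ A.grading i := by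
  rw [evalSection]
  split_ifs with hz
  · exact (U.evalPoint z hz).map_mem hs
  · exact zero_mem _

end Superdomain

/-! ### Morphisms of superdomains induce `A₀`-smooth maps. -/

namespace Superdomain

variable {U V : Superdomain} {A : SuperWeilAlgebra}

/-- A linear retraction of `F` onto `S` recovers `f` from its composite with the inclusion. -/
theorem _root_.Submodule.contDiffOn_of_coe {E F : Type*} [NormedAddCommGroup E] [NormedSpace ℝ E]
    [NormedAddCommGroup F] [NormedSpace ℝ F] [FiniteDimensional ℝ F] (S : Submodule ℝ F)
    {f : E → S} {s : Set E} {n : WithTop ℕ∞} (hf : ContDiffOn ℝ n (fun x => (f x : F)) s) :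
    ContDiffOn ℝ n f s := by
  obtain ⟨r, hr⟩ := S.subtype.exists_leftInverse_of_injective S.ker_subtype
  have h := r.toContinuousLinearMap.contDiff.comp_contDiffOn hf
  refine h.congr fun x _ => ?_
  exact (LinearMap.congr_fun hr (f x)).symm

/-- `A₀`-smoothness of a map into `A₀^m × A₁^n` can be checked on coordinates. -/
theorem smoothOn_and_differential_iff (f : U.CoordSpace A → V.CoordSpace A) :
    (SmoothOn f (U.coordDomain A) ∧
      ∀ z ∈ U.coordDomain A, ∀ (a : A.grading 0) (v : U.CoordSpace A),
        differential f z (U.evenSMul a v) = V.evenSMul a (differential f z v)) ↔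
    (∀ i, U.IsSuperSmooth A fun z => ((f z).1 i : A.carrier)) ∧
      ∀ j, U.IsSuperSmooth A fun z => ((f z).2 j : A.carrier) := by
  have hfd {z : U.CoordSpace A} (hf : DifferentiableAt ℝ f z) (L : V.CoordSpace A →L[ℝ] A.carrier)
      (v : U.CoordSpace A) : fderiv ℝ (fun z => L (f z)) z v = L (fderiv ℝ f z v) := by
    have h := (L.hasFDerivAt.comp z hf.hasFDerivAt).fderiv
    exact congrArg (· v) h
  have hdiff (h : ContDiffOn ℝ ∞ f (U.coordDomain A)) {z} (hz : z ∈ U.coordDomain A) :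
      DifferentiableAt ℝ f z :=
    (h.contDiffAt ((U.isOpen_coordDomain A).mem_nhds hz)).differentiableAt (by simp)
  simp only [smoothOn_iff_contDiffOn, differential_eq_fderiv]
  constructor
  · rintro ⟨h1, h2⟩
    refine ⟨fun i => ⟨(V.evenProj A i).contDiff.comp_contDiffOn h1, fun z hz a v => ?_⟩,
      fun j => ⟨(V.oddProj A j).contDiff.comp_contDiffOn h1, fun z hz a v => ?_⟩⟩
    · have h := hfd (hdiff h1 hz) (V.evenProj A i)
      refine (h _).trans ?_
      rw [h2 z hz]
      exact congrArg ((a : A.carrier) * ·) (h v).symm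
    · have h := hfd (hdiff h1 hz) (V.oddProj A j)
      refine (h _).trans ?_
      rw [h2 z hz]
      exact congrArg ((a : A.carrier) * ·) (h v).symm
  · rintro ⟨h1, h2⟩
    have hs : ContDiffOn ℝ ∞ f (U.coordDomain A) :=
      (contDiffOn_pi.2 fun i => Submodule.contDiffOn_of_coe _ (h1 i).contDiffOn).prodMk
        (contDiffOn_pi.2 fun j => Submodule.contDiffOn_of_coe _ (h2 j).contDiffOn)
    refine ⟨hs, fun z hz a v => ?_⟩
    ext j
    · have h := hfd (hdiff hs hz) (V.evenProj A j)
      refine (h _).symm.trans (((h1 j).fderiv_evenSMul z hz a v).trans ?_)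
      exact congrArg ((a : A.carrier) * ·) (h v)
    · have h := hfd (hdiff hs hz) (V.oddProj A j)
      refine (h _).symm.trans (((h2 j).fderiv_evenSMul z hz a v).trans ?_)
      exact congrArg ((a : A.carrier) * ·) (h v)

/-- The coordinate expression of composition with a morphism of algebras of global sections. -/
def coordMap (ψ : V.globalSections →ₐᵍ[ℝ] U.globalSections) (z : U.CoordSpace A) :
    V.CoordSpace A :=
  (fun i => ⟨U.evalSection (ψ (V.evenCoord i)) z,
      U.evalSection_mem (ψ.map_mem (V.evenCoord i).2) z⟩,
    fun j => ⟨U.evalSection (ψ (V.oddCoord j)) z,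
      U.evalSection_mem (ψ.map_mem (V.oddCoord j).2) z⟩)

theorem coords_comp (ψ : V.globalSections →ₐᵍ[ℝ] U.globalSections)
    (x : U.globalSections →ₐᵍ[ℝ] A.grading) :
    V.coords (A := A) (x.comp ψ) = coordMap ψ (U.coords (A := A) x) := by
  ext j
  · exact (U.evalSection_coords (ψ (V.evenCoord j)) x).symm
  · exact (U.evalSection_coords (ψ (V.oddCoord j)) x).symm

theorem isA0Smooth_onPoints (φ : U.Hom V) (A : SuperWeilAlgebra) :
    IsA0Smooth (φ.onPoints.app A) :=
  ⟨coordMap φ.globalPullback, fun x => coords_comp φ.globalPullback x,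
    (smoothOn_and_differential_iff _).2
      ⟨fun _ => U.isSuperSmooth_evalSection _, fun _ => U.isSuperSmooth_evalSection _⟩⟩

end Superdomain

theorem eq_decompose_zero_add_decompose_one {B : Type*} [Ring B] [Algebra ℝ B]
    (ℬ : ZMod 2 → Submodule ℝ B) [GradedAlgebra ℬ] (b : B) :
    b = DirectSum.decompose ℬ b 0 + DirectSum.decompose ℬ b 1 := by
  induction b using DirectSum.Decomposition.inductionOn ℬ with
  | zero => simp
  | @homogeneous i b =>
    obtain rfl | rfl : i = 0 ∨ i = 1 :=
      (by decide : ∀ i : ZMod 2, i = 0 ∨ i = 1) i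
    · rw [DirectSum.decompose_of_mem_same ℬ b.2, DirectSum.decompose_of_mem_ne ℬ b.2 zero_ne_one,
        add_zero]
    · rw [DirectSum.decompose_of_mem_same ℬ b.2, DirectSum.decompose_of_mem_ne ℬ b.2 one_ne_zero,
        zero_add]
  | add b c hb hc =>
    rw [DirectSum.decompose_add, DirectSum.add_apply, DirectSum.add_apply, Submodule.coe_add,
      Submodule.coe_add, add_add_add_comm, ← hb, ← hc]

/-! ### The Grassmann algebra as a super Weil algebra. -/

section Grassmann

variable {q : ℕ}

theorem ι_mul_ι_comm (v w : Fin q → ℝ) :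
    ExteriorAlgebra.ι ℝ v * ExteriorAlgebra.ι ℝ w =
      -(ExteriorAlgebra.ι ℝ w * ExteriorAlgebra.ι ℝ v) :=
  eq_neg_of_add_eq_zero_left (ExteriorAlgebra.ι_add_mul_swap v w)

/-- Two sign changes cancel when a generator passes a pair of generators. Centrality of such pairs
reduces the sign rule to the scalar and single-generator cases. -/
theorem ι_mul_ι_mul_comm (v w : Fin q → ℝ) (b : Grassmann q) :
    ExteriorAlgebra.ι ℝ v * ExteriorAlgebra.ι ℝ w * b =
      b * (ExteriorAlgebra.ι ℝ v * ExteriorAlgebra.ι ℝ w) := by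
  induction b using ExteriorAlgebra.induction with
  | algebraMap r => exact (Algebra.commutes r _).symm
  | ι m =>
    rw [mul_assoc, ι_mul_ι_comm w m, mul_neg, ← mul_assoc, ι_mul_ι_comm v m, neg_mul, neg_neg,
      mul_assoc]
  | mul a b ha hb => rw [← mul_assoc, ha, mul_assoc, hb, mul_assoc]
  | add a b ha hb => rw [mul_add, add_mul, ha, hb]

theorem grassmann_even_mul_comm {a : Grassmann q} (ha : a ∈ grassmannGrading q 0)
    (b : Grassmann q) : a * b = b * a := by
  induction a, ha using CliffordAlgebra.even_induction with
  | algebraMap r => exact Algebra.commutes r b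
  | add x y _ _ hx hy => rw [mul_add, add_mul, hx, hy]
  | ι_mul_ι_mul v w x _ hx =>
    rw [mul_assoc, hx, ← mul_assoc, ← mul_assoc]
    exact congrArg (· * x) (ι_mul_ι_mul_comm v w b)

theorem grassmann_odd_mul_comm {a b : Grassmann q} (ha : a ∈ grassmannGrading q 1)
    (hb : b ∈ grassmannGrading q 1) : a * b = -(b * a) := by
  induction a, ha using CliffordAlgebra.odd_induction with
  | ι v =>
    induction b, hb using CliffordAlgebra.odd_induction with
    | ι w => exact ι_mul_ι_comm v w
    | add x y _ _ hx hy => rw [mul_add, add_mul, hx, hy, neg_add]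
    | ι_mul_ι_mul w w' x _ hx =>
      rw [← mul_assoc, ← ι_mul_ι_mul_comm w w', mul_assoc, hx, mul_neg, ← mul_assoc]
  | add x y _ _ hx hy => rw [mul_add, add_mul, hx, hy, neg_add]
  | ι_mul_ι_mul w w' x _ hx =>
    rw [mul_assoc, hx, mul_neg, ← mul_assoc, ← mul_assoc]
    exact congrArg (fun y => -(y * x)) (ι_mul_ι_mul_comm w w' b)

open ExteriorAlgebra in
/-- The augmentation ideal of the Grassmann algebra. -/
def grassmannNil (q : ℕ) : Ideal (Grassmann q) :=
  RingHom.ker (algebraMapInv (R := ℝ) (M := Fin q → ℝ))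

open ExteriorAlgebra in
theorem sub_algebraMapInv_mem (a : Grassmann q) :
    a - algebraMap ℝ _ (algebraMapInv a) ∈ LinearMap.range (ι ℝ (M := Fin q → ℝ)) * ⊤ := by
  induction a using ExteriorAlgebra.induction with
  | algebraMap r => simp [algebraMap_leftInverse (Fin q → ℝ) r]
  | ι m =>
    have h : algebraMapInv (ι ℝ m) = 0 := by simp [algebraMapInv]
    rw [h, map_zero, sub_zero, ← mul_one (ι ℝ m)]
    exact Submodule.mul_mem_mul ⟨m, rfl⟩ trivial
  | mul a b ha hb =>
    have : a * b - algebraMap ℝ _ (algebraMapInv (a * b)) =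
        (a - algebraMap ℝ _ (algebraMapInv a)) * b +
          algebraMapInv a • (b - algebraMap ℝ _ (algebraMapInv b)) := by
      rw [Algebra.smul_def, map_mul, map_mul]
      noncomm_ring
    rw [this]
    refine add_mem ?_ (Submodule.smul_mem _ _ hb)
    have h := Submodule.mul_mem_mul ha (Submodule.mem_top (x := b) (R := ℝ))
    rw [mul_assoc] at h
    exact Submodule.smul_mono le_rfl le_top h
  | add a b ha hb =>
    rw [map_add, map_add, add_sub_add_comm]
    exact add_mem ha hb

open ExteriorAlgebra in
theorem mul_mem_range_ι_pow_succ (k : ℕ) {a b : Grassmann q}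
    (ha : a ∈ LinearMap.range (ι ℝ (M := Fin q → ℝ)) ^ k * (⊤ : Submodule ℝ (Grassmann q)))
    (hb : b ∈ grassmannNil q) :
    a * b ∈ LinearMap.range (ι ℝ (M := Fin q → ℝ)) ^ (k + 1) *
      (⊤ : Submodule ℝ (Grassmann q)) := by
  refine Submodule.mul_induction_on ha (fun x hx t _ => ?_) fun x y hx hy => ?_
  · have htb := sub_algebraMapInv_mem (t * b)
    have hb' : algebraMapInv b = 0 := hb
    rw [map_mul, hb', mul_zero, map_zero, sub_zero] at htb
    rw [mul_assoc, pow_succ, mul_assoc]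
    exact Submodule.mul_mem_mul hx htb
  · rw [add_mul]; exact add_mem hx hy

open ExteriorAlgebra in
theorem mem_range_ι_pow_of_mem_grassmannNil_pow (k : ℕ) {a : Grassmann q}
    (ha : a ∈ grassmannNil q ^ k) :
    a ∈ LinearMap.range (ι ℝ (M := Fin q → ℝ)) ^ k * (⊤ : Submodule ℝ (Grassmann q)) := by
  induction k generalizing a with
  | zero =>
    rw [pow_zero, one_mul]; trivial
  | succ k ih =>
    rw [Submodule.pow_succ] at ha
    exact Submodule.mul_induction_on ha
      (fun x hx y hy => mul_mem_range_ι_pow_succ k (ih hx) hy) fun x y hx hy => add_mem hx hy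

/-- The `k`-th power of the augmentation ideal lies in the ideal generated by `k`-fold products of
generators, and the exterior power of degree `q + 1` of a `q`-dimensional space is zero. -/
theorem isNilpotent_grassmannNil (q : ℕ) : IsNilpotent (grassmannNil q) := by
  refine ⟨q + 1, ?_⟩
  have hzero : LinearMap.range (ExteriorAlgebra.ι ℝ (M := Fin q → ℝ)) ^ (q + 1) = ⊥ := by
    have h : Module.finrank ℝ (⋀[ℝ]^(q + 1) (Fin q → ℝ)) = 0 := by
      rw [exteriorPower.finrank_eq]; simp
    exact Submodule.finrank_eq_zero.1 h
  refine (Submodule.eq_bot_iff _).2 fun a ha => ?_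
  have := mem_range_ι_pow_of_mem_grassmannNil_pow (q + 1) ha
  rw [hzero, Submodule.bot_mul] at this
  exact this

theorem algebraMapInv_odd {a : Grassmann q} (ha : a ∈ grassmannGrading q 1) :
    ExteriorAlgebra.algebraMapInv (R := ℝ) a = 0 := by
  have h := congrArg (ExteriorAlgebra.algebraMapInv (R := ℝ)) (grassmann_odd_mul_comm ha ha)
  rw [map_neg, map_mul] at h
  nlinarith

instance : Module.Finite ℝ (Grassmann q) :=
  Module.Finite.of_basis ((Pi.basisFun ℝ (Fin q)).ExteriorAlgebra)

/-- The Grassmann algebra as a super Weil algebra. -/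
def grassmannWeil (q : ℕ) : SuperWeilAlgebra where
  carrier := Grassmann q
  grading := grassmannGrading q
  supercomm i j a ha b hb := by
    fin_cases i <;> fin_cases j
    · exact (grassmann_even_mul_comm ha b).trans (one_mul _).symm
    · exact (grassmann_even_mul_comm ha b).trans (one_mul _).symm
    · exact (grassmann_even_mul_comm hb a).symm.trans (one_mul _).symm
    · refine (grassmann_odd_mul_comm ha hb).trans ?_
      change _ = (-1 : Grassmann q) ^ 1 * (b * a)
      rw [pow_one, neg_one_mul]
  nil := grassmannNil q
  nil_isTwoSided := RingHom.instIsTwoSidedKer _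
  nil_isHomogeneous := by
    intro i a ha
    have hodd := algebraMapInv_odd (DirectSum.decompose (grassmannGrading q) a 1).2
    have ha' : ExteriorAlgebra.algebraMapInv a = 0 := ha
    change ExteriorAlgebra.algebraMapInv
      (DirectSum.decompose (grassmannGrading q) a i : Grassmann q) = 0
    have h2 := eq_decompose_zero_add_decompose_one (grassmannGrading q) a
    have h3 := congrArg (ExteriorAlgebra.algebraMapInv) h2
    rw [map_add, hodd, ha', add_zero] at h3
    fin_cases i
    · exact h3.symm
    · exact hodd
  nil_isNilpotent := isNilpotent_grassmannNil q
  isCompl_nil := by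
    constructor
    · rw [Submodule.disjoint_def]
      rintro a h1 h2
      obtain ⟨r, rfl⟩ := Submodule.mem_one.1 h1
      have h2' : ExteriorAlgebra.algebraMapInv (algebraMap ℝ (Grassmann q) r) = 0 := h2
      rw [ExteriorAlgebra.algebraMap_leftInverse] at h2'
      rw [h2', map_zero]
    · rw [codisjoint_iff, Submodule.eq_top_iff']
      intro a
      refine Submodule.mem_sup.2 ⟨_, Submodule.algebraMap_mem (ExteriorAlgebra.algebraMapInv a),
        a - algebraMap ℝ _ (ExteriorAlgebra.algebraMapInv a), ?_, by abel⟩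
      change ExteriorAlgebra.algebraMapInv _ = 0
      rw [map_sub, ExteriorAlgebra.algebraMap_leftInverse, sub_self]

end Grassmann

/-! ### Sections as smooth Grassmann-valued functions. -/

section EvalGrassmann

variable {p q : ℕ} {W : Opens (EuclideanSpace ℝ (Fin p))}

/-- Evaluation of the coefficients of a section at a point. -/
def evalGrassmann (q : ℕ) (x : W) : Sections p q W →ₐ[ℝ] Grassmann q :=
  Algebra.TensorProduct.lift ((Algebra.ofId ℝ (Grassmann q)).comp (evalFun p x))
    (AlgHom.id ℝ (Grassmann q)) fun f l => Algebra.commutes (evalFun p x f) l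

theorem evalGrassmann_tmul (x : W) (f : SmoothFun p W) (l : Grassmann q) :
    evalGrassmann q x (f ⊗ₜ l) = algebraMap ℝ (Grassmann q) (f x) * l :=
  rfl

theorem repr_evalGrassmann {ι : Type*} (b : Module.Basis ι ℝ (Grassmann q)) (x : W)
    (s : Sections p q W) (i : ι) :
    b.repr (evalGrassmann q x s) i =
      (Algebra.TensorProduct.basis (SmoothFun p W) b).repr s i x := by
  induction s using TensorProduct.induction_on with
  | zero => rw [map_zero, map_zero, map_zero]; rfl
  | tmul f l =>
    rw [evalGrassmann_tmul, ← Algebra.smul_def, Algebra.TensorProduct.basis_repr_tmul, map_smul]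
    rfl
  | add s t hs ht =>
    rw [map_add, map_add, map_add, Finsupp.add_apply, Finsupp.add_apply]
    exact congrArg₂ (· + ·) hs ht

/-- A basis of the Grassmann algebra is a basis of the sections over the smooth functions, and
smooth functions are determined by their values. -/
theorem section_ext {s t : Sections p q W}
    (h : ∀ x : W, evalGrassmann q x s = evalGrassmann q x t) : s = t := by
  let b := (Pi.basisFun ℝ (Fin q)).ExteriorAlgebra
  refine (Algebra.TensorProduct.basis (SmoothFun p W) b).repr.injective ?_
  ext i x
  rw [← repr_evalGrassmann, ← repr_evalGrassmann, h]

theorem evalGrassmann_mem (x : W) {i : ZMod 2} {s : Sections p q W}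
    (hs : s ∈ sectionsGrading p q W i) : evalGrassmann q x s ∈ grassmannGrading q i := by
  refine sectionsGrading_induction
    (motive := fun s => evalGrassmann q x s ∈ grassmannGrading q i) (fun f l hl => ?_) ?_
    (fun s t hs ht => ?_) hs
  · rw [evalGrassmann_tmul, ← Algebra.smul_def]
    exact Submodule.smul_mem _ _ hl
  · rw [map_zero]; exact zero_mem _
  · rw [map_add]; exact add_mem hs ht

/-- The component of the wrong parity takes values that are both even and odd, hence zero. -/
theorem mem_sectionsGrading_of_evalGrassmann_mem {i : ZMod 2} {s : Sections p q W}
    (h : ∀ x : W, evalGrassmann q x s ∈ grassmannGrading q i) :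
    s ∈ sectionsGrading p q W i := by
  have hs := eq_decompose_zero_add_decompose_one (sectionsGrading p q W) s
  have h0 := (DirectSum.decompose (sectionsGrading p q W) s 0).2
  have h1 := (DirectSum.decompose (sectionsGrading p q W) s 1).2
  generalize (DirectSum.decompose (sectionsGrading p q W) s 0 : Sections p q W) = s0 at hs h0
  generalize (DirectSum.decompose (sectionsGrading p q W) s 1 : Sections p q W) = s1 at hs h1
  have hdisj := Submodule.disjoint_def.1
    (CliffordAlgebra.evenOdd_isCompl (0 : QuadraticForm ℝ (Fin q → ℝ))).disjoint
  obtain rfl | rfl : i = 0 ∨ i = 1 := (by decide : ∀ i : ZMod 2, i = 0 ∨ i = 1) i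
  · have : s1 = 0 := section_ext fun x => by
      rw [map_zero]
      refine hdisj _ ?_ (evalGrassmann_mem x h1)
      have := sub_mem (h x) (evalGrassmann_mem x h0)
      rwa [hs, map_add, add_sub_cancel_left] at this
    rwa [hs, this, add_zero]
  · have : s0 = 0 := section_ext fun x => by
      rw [map_zero]
      refine hdisj _ (evalGrassmann_mem x h0) ?_
      have := sub_mem (h x) (evalGrassmann_mem x h1)
      rwa [hs, map_add, add_sub_cancel_right] at this
    rwa [hs, this, zero_add]

/-- The section of the structure sheaf with given smooth Grassmann-valued coefficients. -/
def sectionOfContDiffOn (g : EuclideanSpace ℝ (Fin p) → (grassmannWeil q).carrier)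
    (hg : ContDiffOn ℝ ∞ g W) : Sections p q W :=
  let b := Module.finBasis ℝ (grassmannWeil q).carrier
  ∑ i, (smoothFunOfContDiffOn (fun x => b.coord i (g x))
    ((b.coord i).toContinuousLinearMap.contDiff.comp_contDiffOn hg) : SmoothFun p W) ⊗ₜ
      (show Grassmann q from b i)

theorem evalGrassmann_sectionOfContDiffOn
    (g : EuclideanSpace ℝ (Fin p) → (grassmannWeil q).carrier)
    (hg : ContDiffOn ℝ ∞ g W) (x : W) : evalGrassmann q x (sectionOfContDiffOn g hg) = g x := by
  let b := Module.finBasis ℝ (grassmannWeil q).carrier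
  rw [sectionOfContDiffOn, map_sum]
  refine Eq.trans (Finset.sum_congr rfl fun i _ => ?_) (b.sum_repr (g x))
  exact (Algebra.smul_def (b.coord i (g x)) (show Grassmann q from b i)).symm

/-- A family of graded morphisms to the Grassmann algebra depending smoothly on a point defines
a graded morphism to the algebra of sections. -/
def sectionHom {B : Type*} [Ring B] [Algebra ℝ B] (ℬ : ZMod 2 → Submodule ℝ B) [GradedAlgebra ℬ]
    (h : W → (ℬ →ₐᵍ[ℝ] grassmannGrading q))
    (F : B → EuclideanSpace ℝ (Fin p) → (grassmannWeil q).carrier)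
    (hF : ∀ b, ContDiffOn ℝ ∞ (F b) W) (hFh : ∀ b (x : W), F b x = h x b) :
    ℬ →ₐᵍ[ℝ] sectionsGrading p q W :=
  have key (b : B) (x : W) : evalGrassmann q x (sectionOfContDiffOn (F b) (hF b)) = h x b :=
    (evalGrassmann_sectionOfContDiffOn _ _ x).trans (hFh b x)
  { AlgHom.ofLinearMap
      { toFun := fun b => sectionOfContDiffOn (F b) (hF b)
        map_add' := fun b c => section_ext fun x => by simp only [map_add, key]
        map_smul' := fun r b => section_ext fun x => by
          simp only [map_smul, key, RingHom.id_apply] }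
      (section_ext fun x => by
        simp only [LinearMap.coe_mk, AddHom.coe_mk, map_one, key])
      (fun b c => section_ext fun x => by
        simp only [LinearMap.coe_mk, AddHom.coe_mk, map_mul, key]) with
    map_mem := fun {i b} hb => mem_sectionsGrading_of_evalGrassmann_mem fun x => by
      refine Set.mem_of_eq_of_mem (key b x) ?_
      exact (h x).map_mem hb }

theorem evalGrassmann_sectionHom {B : Type*} [Ring B] [Algebra ℝ B] (ℬ : ZMod 2 → Submodule ℝ B)
    [GradedAlgebra ℬ] (h : W → (ℬ →ₐᵍ[ℝ] grassmannGrading q))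
    (F : B → EuclideanSpace ℝ (Fin p) → (grassmannWeil q).carrier)
    (hF : ∀ b, ContDiffOn ℝ ∞ (F b) W) (hFh : ∀ b (x : W), F b x = h x b) (b : B) (x : W) :
    evalGrassmann q x (sectionHom ℬ h F hF hFh b) = h x b :=
  (evalGrassmann_sectionOfContDiffOn (F b) (hF b) x).trans (hFh b x)

theorem evalGrassmann_restrict {W' : Opens (EuclideanSpace ℝ (Fin p))} (hW : W' ≤ W)
    (s : Sections p q W) (x : W') :
    evalGrassmann q x (restrict p q hW s) = evalGrassmann q ⟨x, hW x.2⟩ s := by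
  induction s using TensorProduct.induction_on with
  | zero => rw [map_zero, map_zero, map_zero]
  | tmul f l => rfl
  | add s t hs ht => rw [map_add, map_add, map_add, hs, ht]

theorem body_grassmannWeil (a : (grassmannWeil q).carrier) :
    (grassmannWeil q).body a = ExteriorAlgebra.algebraMapInv (R := ℝ) (M := Fin q → ℝ) a := by
  rw [SuperWeilAlgebra.body_eq_iff]
  change ExteriorAlgebra.algebraMapInv (R := ℝ) (M := Fin q → ℝ) _ = 0
  refine (map_sub (ExteriorAlgebra.algebraMapInv (R := ℝ) (M := Fin q → ℝ)) a _).trans ?_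
  exact sub_eq_zero.2 (ExteriorAlgebra.algebraMap_leftInverse _ _).symm

theorem value_eq_body_evalGrassmann (x : W) (s : Sections p q W) :
    value p q x s = (grassmannWeil q).body (evalGrassmann q x s) := by
  refine Eq.trans ?_ (body_grassmannWeil (evalGrassmann q x s)).symm
  induction s using TensorProduct.induction_on with
  | zero => rw [map_zero, map_zero]; exact (map_zero _).symm
  | tmul f l =>
    rw [evalGrassmann_tmul]
    refine Eq.trans ?_ (map_mul ExteriorAlgebra.algebraMapInv _ _).symm
    rw [ExteriorAlgebra.algebraMap_leftInverse]
    rfl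
  | add s t hs ht =>
    rw [map_add, map_add, hs, ht]
    exact (map_add ExteriorAlgebra.algebraMapInv _ _).symm

/-- The generators of the Grassmann algebra as odd elements. -/
def grassmannGen (q : ℕ) (j : Fin q) : (grassmannWeil q).grading 1 :=
  ⟨ExteriorAlgebra.ι ℝ (Pi.single j (1 : ℝ)), CliffordAlgebra.ι_mem_evenOdd_one _ _⟩

theorem oddEval_grassmannGen (l : Grassmann q) : Superdomain.oddEval (grassmannGen q) l = l := by
  have : (Superdomain.oddEval (grassmannGen q) : Grassmann q →ₐ[ℝ] Grassmann q) =
      AlgHom.id ℝ (Grassmann q) := by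
    refine ExteriorAlgebra.hom_ext (LinearMap.pi_ext' fun j => LinearMap.ext_ring ?_)
    refine (Superdomain.oddEval_ι (grassmannGen q) (Pi.single j 1)).trans ?_
    simp only [Pi.single_apply, ite_smul, one_smul, zero_smul, Finset.sum_ite_eq',
      Finset.mem_univ, if_true]
    rfl
  exact DFunLike.congr_fun this l

end EvalGrassmann

/-! ### Generic points, values and restriction. -/

namespace Superdomain

variable (U V : Superdomain) {A : SuperWeilAlgebra}

theorem realPoint_mem_coordDomain {u : EuclideanSpace ℝ (Fin U.evenDim)} (hu : u ∈ U.carrier)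
    (ζ : Fin U.oddDim → A.grading 1) : U.realPoint u ζ ∈ U.coordDomain A := by
  rwa [mem_coordDomain_iff, realPart_realPoint]

/-- At a generic point the even coordinates are real, so no Taylor correction appears, and the odd
generators go to themselves. Generic points therefore see all Grassmann coefficients of a section at
`u`. -/
theorem evalPoint_grassmannGen {u : EuclideanSpace ℝ (Fin U.evenDim)} (hu : u ∈ U.carrier)
    (s : Sections U.evenDim U.oddDim U.carrier) :
    U.evalPoint _ (U.realPoint_mem_coordDomain hu (grassmannGen U.oddDim)) s =
      evalGrassmann U.oddDim ⟨u, hu⟩ s := by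
  induction s using TensorProduct.induction_on with
  | zero => rw [map_zero, map_zero]; rfl
  | tmul f l =>
    rw [evalPoint_tmul, weilExtension_realPoint, extendFun_coe f ⟨u, hu⟩, evalGrassmann_tmul]
    exact congrArg (_ * ·) (oddEval_grassmannGen l)
  | add s t hs ht => rw [map_add, map_add, hs, ht]; rfl

/-- The real part of a point is a character: on smooth functions it is the evaluation at the real
coordinates, and it kills odd elements. This makes the constructed pullbacks local on stalks. -/
theorem body_evalPoint (z : U.CoordSpace A) (hz : z ∈ U.coordDomain A)
    (s : Sections U.evenDim U.oddDim U.carrier) :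
    A.body (U.evalPoint z hz s) =
      value U.evenDim U.oddDim (⟨U.realPart A z, U.mem_coordDomain_iff.1 hz⟩ : U.carrier) s := by
  have h : A.body.comp (U.evalPoint z hz).toAlgHom = value U.evenDim U.oddDim
      (⟨U.realPart A z, U.mem_coordDomain_iff.1 hz⟩ : U.carrier) := by
    refine Algebra.TensorProduct.ext ?_ ?_
    · obtain ⟨x, hx⟩ := exists_eq_eval (A.body.comp (U.evenRestriction (U.evalPoint z hz)))
      have hxz : x = ⟨U.realPart A z, U.mem_coordDomain_iff.1 hz⟩ := by
        refine Subtype.ext (PiLp.ext fun i => ?_)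
        refine (hx (coordFun i)).symm.trans ?_
        have := congrArg Subtype.val (congrFun (congrArg Prod.fst (U.coords_evalPoint z hz)) i)
        exact congrArg A.body this
      refine AlgHom.ext fun f => ?_
      refine (hx f).trans ?_
      rw [hxz]
      change _ = value _ _ _ (f ⊗ₜ 1)
      rw [value, Algebra.TensorProduct.lift_tmul, map_one, mul_one]
      rfl
    · refine ExteriorAlgebra.hom_ext (LinearMap.ext fun m => ?_)
      change A.body (U.evalPoint z hz (1 ⊗ₜ ExteriorAlgebra.ι ℝ m)) =
        value _ _ _ (1 ⊗ₜ ExteriorAlgebra.ι ℝ m)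
      refine (A.odd_body_eq_zero ((U.evalPoint z hz).map_mem
        (tmul_mem_sectionsGrading 1 (CliffordAlgebra.ι_mem_evenOdd_one _ m)))).trans ?_
      rw [value, Algebra.TensorProduct.lift_tmul,
        algebraMapInv_odd (CliffordAlgebra.ι_mem_evenOdd_one _ m), mul_zero]
  exact DFunLike.congr_fun h s

/-- The restriction of a superdomain to an open set. -/
abbrev restrictTo (W : Opens (EuclideanSpace ℝ (Fin V.evenDim))) : Superdomain :=
  ⟨V.evenDim, V.oddDim, W⟩

/-- Composing a point over `W'` with restriction gives a point over `W` with the same coordinates,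
and coordinates determine a point. Compatibility of the pullbacks with restriction follows. -/
theorem evalPoint_restrict {W' W : Opens (EuclideanSpace ℝ (Fin V.evenDim))} (h : W' ≤ W)
    (z : V.CoordSpace A) (hz' : z ∈ (V.restrictTo W').coordDomain A)
    (hz : z ∈ (V.restrictTo W).coordDomain A) (s : Sections V.evenDim V.oddDim W) :
    (V.restrictTo W').evalPoint z hz' (restrict V.evenDim V.oddDim h s) =
      (V.restrictTo W).evalPoint z hz s := by
  have key : ((V.restrictTo W').evalPoint z hz').comp (restrict V.evenDim V.oddDim h) =
      (V.restrictTo W).evalPoint z hz := by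
    refine (V.restrictTo W).point_ext ?_
    rw [coords_evalPoint]
    exact (V.restrictTo W').coords_evalPoint z hz'
  exact DFunLike.congr_fun key s

end Superdomain

/-! ### Reconstructing a morphism from its generic points. -/

namespace Superdomain

variable {U V : Superdomain}

section OfCoords

variable (β : EuclideanSpace ℝ (Fin U.evenDim) → V.CoordSpace (grassmannWeil U.oddDim))
  (hβ : ContDiffOn ℝ ∞ β U.carrier)
  (hmem : ∀ u ∈ U.carrier, β u ∈ V.coordDomain (grassmannWeil U.oddDim))

/-- The continuous map underlying a smooth family of Grassmann-valued points. -/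
def baseOfCoords : C(U.carrier, V.carrier) where
  toFun u := ⟨V.realPart _ (β u), V.mem_coordDomain_iff.1 (hmem u u.2)⟩
  continuous_toFun := Continuous.subtype_mk
    ((V.realPart _).continuous.comp (continuousOn_iff_continuous_domRestrict.1 hβ.continuousOn)) _

theorem preimage_le_carrier (f : C(U.carrier, V.carrier))
    (W : Opens (EuclideanSpace ℝ (Fin V.evenDim))) : preimage f W ≤ U.carrier := by
  rintro _ ⟨x, -, rfl⟩
  exact x.2

theorem mem_coordDomain_of_mem_preimage {W : Opens (EuclideanSpace ℝ (Fin V.evenDim))}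
    {u : EuclideanSpace ℝ (Fin U.evenDim)} (hu : u ∈ preimage (baseOfCoords β hβ hmem) W) :
    β u ∈ (V.restrictTo W).coordDomain (grassmannWeil U.oddDim) := by
  obtain ⟨x, hx, rfl⟩ := hu
  exact (V.restrictTo W).mem_coordDomain_iff.2 hx

/-- The pullback of sections along a smooth family of Grassmann-valued points. -/
def pullbackOfCoords (W : Opens (EuclideanSpace ℝ (Fin V.evenDim))) :
    V.sheaf W →ₐᵍ[ℝ] U.sheaf (preimage (baseOfCoords β hβ hmem) W) :=
  sectionHom (V.sheaf W)
    (fun u => (V.restrictTo W).evalPoint (β u) (mem_coordDomain_of_mem_preimage β hβ hmem u.2))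
    (fun s u => (V.restrictTo W).evalSection s (β u))
    (fun s => ((V.restrictTo W).isSuperSmooth_evalSection s).contDiffOn.comp
      (hβ.mono (preimage_le_carrier _ W))
      fun _ hu => mem_coordDomain_of_mem_preimage β hβ hmem hu)
    (fun s u => (V.restrictTo W).evalSection_of_mem s
      (mem_coordDomain_of_mem_preimage β hβ hmem u.2))

theorem evalGrassmann_pullbackOfCoords (W : Opens (EuclideanSpace ℝ (Fin V.evenDim)))
    (s : Sections V.evenDim V.oddDim W) (u : preimage (baseOfCoords β hβ hmem) W) :
    evalGrassmann U.oddDim u (pullbackOfCoords β hβ hmem W s) =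
      (V.restrictTo W).evalPoint (β u) (mem_coordDomain_of_mem_preimage β hβ hmem u.2) s :=
  evalGrassmann_sectionHom _ _ _ _ _ s u

/-- The morphism of superdomains determined by a smooth family of Grassmann-valued points. -/
def homOfCoords : U.Hom V where
  base := baseOfCoords β hβ hmem
  pullback W _ := pullbackOfCoords β hβ hmem W
  pullback_restrict W' W h hW s := section_ext fun u => by
    rw [evalGrassmann_restrict]
    refine (evalGrassmann_pullbackOfCoords β hβ hmem W s _).trans
      (Eq.trans ?_ (evalGrassmann_pullbackOfCoords β hβ hmem W' _ u).symm)
    exact (V.evalPoint_restrict h (β u) _ _ s).symm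
  pullback_local W hW x hx s hs := by
    rw [value_eq_body_evalGrassmann]
    refine (congrArg _ (evalGrassmann_pullbackOfCoords β hβ hmem W s _)).trans ?_
    exact ((V.restrictTo W).body_evalPoint _ _ s).trans hs

theorem evalPoint_comp_globalPullback_homOfCoords {u : EuclideanSpace ℝ (Fin U.evenDim)}
    (hu : u ∈ U.carrier) :
    (U.evalPoint _ (U.realPoint_mem_coordDomain hu (grassmannGen U.oddDim))).comp
      (homOfCoords β hβ hmem).globalPullback = V.evalPoint (β u) (hmem u hu) := by
  ext s
  refine (U.evalPoint_grassmannGen hu _).trans ?_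
  refine (evalGrassmann_restrict
    (le_preimage_carrier (homOfCoords β hβ hmem).base) _ ⟨u, hu⟩).trans ?_
  exact evalGrassmann_pullbackOfCoords β hβ hmem V.carrier s _

end OfCoords

/-- The morphism of super Weil algebras from a Grassmann algebra sending the generators to given
odd elements. -/
def grassmannHom {A : SuperWeilAlgebra} {q : ℕ} (ζ : Fin q → A.grading 1) :
    (grassmannWeil q).grading →ₐᵍ[ℝ] A.grading :=
  { (oddEval ζ : Grassmann q →ₐ[ℝ] A.carrier) with
    map_mem := fun h => oddEval_mem ζ h }

theorem grassmannHom_comp_evalPoint {A : SuperWeilAlgebra} {u : EuclideanSpace ℝ (Fin U.evenDim)}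
    (hu : u ∈ U.carrier) (ζ : Fin U.oddDim → A.grading 1) :
    (grassmannHom ζ).comp
      (U.evalPoint _ (U.realPoint_mem_coordDomain hu (grassmannGen U.oddDim))) =
      U.evalPoint _ (U.realPoint_mem_coordDomain hu ζ) := by
  have key (s : Sections U.evenDim U.oddDim U.carrier) :
      oddEval ζ (evalGrassmann U.oddDim ⟨u, hu⟩ s) =
        U.evalPoint _ (U.realPoint_mem_coordDomain hu ζ) s := by
    induction s using TensorProduct.induction_on with
    | zero => simp only [map_zero]
    | tmul f l =>
      rw [evalPoint_tmul, weilExtension_realPoint, extendFun_coe f ⟨u, hu⟩, evalGrassmann_tmul,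
        map_mul, AlgHom.commutes]
      rfl
    | add s t hs ht => rw [map_add, map_add, map_add, hs, ht]
  ext s
  exact (congrArg (oddEval ζ) (U.evalPoint_grassmannGen hu s)).trans (key s)

/-- The `A`-point of `U` with real even coordinates `u` and odd coordinates `ζ`. -/
def pointAt {A : SuperWeilAlgebra} (u : U.carrier) (ζ : Fin U.oddDim → A.grading 1) :
    U.points.obj A :=
  U.evalPoint _ (U.realPoint_mem_coordDomain u.2 ζ)

theorem coords_pointAt {A : SuperWeilAlgebra} (u : U.carrier) (ζ : Fin U.oddDim → A.grading 1) :
    U.coords (pointAt u ζ) = U.realPoint u ζ :=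
  U.coords_evalPoint _ _

theorem map_grassmannHom_pointAt {A : SuperWeilAlgebra} (u : U.carrier)
    (ζ : Fin U.oddDim → A.grading 1) :
    U.points.map (X := grassmannWeil U.oddDim) (Y := A) (grassmannHom ζ)
      (pointAt u (grassmannGen U.oddDim)) = pointAt u ζ :=
  grassmannHom_comp_evalPoint u.2 ζ

/-- A natural transformation is determined by its values at the generic points. -/
theorem app_pointAt_eq {α γ : U.points ⟶ V.points}
    (h : ∀ u : U.carrier, α.app _ (pointAt u (grassmannGen U.oddDim)) =
      γ.app _ (pointAt u (grassmannGen U.oddDim)))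
    {A : SuperWeilAlgebra} (u : U.carrier) (ζ : Fin U.oddDim → A.grading 1) :
    α.app A (pointAt u ζ) = γ.app A (pointAt u ζ) := by
  rw [← map_grassmannHom_pointAt, NatTrans.naturality_apply, NatTrans.naturality_apply, h]

/-- Naturality gives agreement at all points with real even coordinates, over every `A`; rigidity,
applied to each coordinate of the two maps, gives the rest. -/
theorem eq_of_isA0Smooth {α γ : U.points ⟶ V.points}
    (hα : ∀ A : SuperWeilAlgebra, IsA0Smooth (α.app A))
    (hγ : ∀ A : SuperWeilAlgebra, IsA0Smooth (γ.app A))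
    (h : ∀ u : U.carrier, α.app _ (pointAt u (grassmannGen U.oddDim)) =
      γ.app _ (pointAt u (grassmannGen U.oddDim))) : α = γ := by
  ext A x
  obtain ⟨f, hf, hfs⟩ := hα A
  obtain ⟨g, hg, hgs⟩ := hγ A
  rw [smoothOn_and_differential_iff] at hfs hgs
  have hfg (u : EuclideanSpace ℝ (Fin U.evenDim)) (hu : u ∈ U.carrier)
      (ζ : Fin U.oddDim → A.grading 1) : f (U.realPoint u ζ) = g (U.realPoint u ζ) := by
    have h1 := hf (pointAt ⟨u, hu⟩ ζ)
    have h2 := hg (pointAt ⟨u, hu⟩ ζ)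
    rw [coords_pointAt] at h1 h2
    rw [← h1, ← h2, app_pointAt_eq h]
  have hx := U.coords_mem_coordDomain x
  refine V.point_ext ((hf x).trans (Eq.trans ?_ (hg x).symm))
  ext j
  · exact (hfs.1 j).eq_of_eq_realPoint (hgs.1 j) (fun u hu ζ => by rw [hfg u hu ζ]) _ hx
  · exact (hfs.2 j).eq_of_eq_realPoint (hgs.2 j) (fun u hu ζ => by rw [hfg u hu ζ]) _ hx

theorem contDiff_realPoint {A : SuperWeilAlgebra} (ζ : Fin U.oddDim → A.grading 1) :
    ContDiff ℝ ∞ fun u => U.realPoint u ζ := by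
  refine ContDiff.prodMk (contDiff_pi.2 fun i => ?_) contDiff_const
  rw [← contDiffOn_univ]
  refine Submodule.contDiffOn_of_coe _ ?_
  exact ((Algebra.linearMap ℝ A.carrier).toContinuousLinearMap.contDiff.comp
    (contDiff_piLp_apply 2)).contDiffOn

theorem exists_hom_of_isA0Smooth (α : U.points ⟶ V.points)
    (hα : ∀ A : SuperWeilAlgebra, IsA0Smooth (α.app A)) : ∃ φ : U.Hom V, φ.onPoints = α := by
  obtain ⟨f, hf, hfs⟩ := hα (grassmannWeil U.oddDim)
  -- Only the component of `α` at this Grassmann algebra enters the construction of `φ`; the other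
  -- components serve to show that `φ` induces `α`.
  let β : EuclideanSpace ℝ (Fin U.evenDim) → V.CoordSpace (grassmannWeil U.oddDim) :=
    fun u => f (U.realPoint u (grassmannGen U.oddDim))
  have hβα (u : U.carrier) : V.coords (α.app _ (pointAt u (grassmannGen U.oddDim))) = β u := by
    rw [hf, coords_pointAt]
  have hβ : ContDiffOn ℝ ∞ β U.carrier :=
    ((smoothOn_iff_contDiffOn _ _).1 hfs.1).comp (contDiff_realPoint _).contDiffOn
      fun u hu => U.realPoint_mem_coordDomain hu _
  have hmem : ∀ u ∈ U.carrier, β u ∈ V.coordDomain (grassmannWeil U.oddDim) := fun u hu => by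
    rw [← hβα ⟨u, hu⟩]
    exact V.coords_mem_coordDomain _
  refine ⟨homOfCoords β hβ hmem, eq_of_isA0Smooth (isA0Smooth_onPoints _) hα fun u => ?_⟩
  refine (evalPoint_comp_globalPullback_homOfCoords β hβ hmem u.2).trans (V.point_ext ?_)
  exact (V.coords_evalPoint _ _).trans (hβα u).symm

end Superdomain

end SuperGeometry

end

theorem mainTheorem4 (U V : SuperGeometry.Superdomain) (α : U.points ⟶ V.points) :
    (∃ φ : U.Hom V, φ.onPoints = α) ↔
      ∀ A : SuperGeometry.SuperWeilAlgebra, SuperGeometry.IsA0Smooth (α.app A) := by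
  refine ⟨?_, SuperGeometry.Superdomain.exists_hom_of_isA0Smooth α⟩
  rintro ⟨φ, rfl⟩ A
  exact SuperGeometry.Superdomain.isA0Smooth_onPoints φ A
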